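/- Let $K$ be a field; all vector spaces, algebras and tensor products are over $K$. Definitions. A $2$-ass algebra is a vector space with two associative bilinear products $\cdot$ and $\circ$. A $\mathrm{Mag}(\infty)$ algebra is a vector space $M$ with an $n$-linear operation $\mu_n : M^{\otimes n}\to M$ for each $n\ge 2$ (and no relations). Every $2$-ass algebra carries the operations $$\mu_2(x_1,x_2)=x_1\cdot x_2-x_1\circ x_2,$$ $$\mu_n(x_1,\dots,x_n)=(x_1\cdot x_2\cdots x_{n-1})\circ x_n-x_1\cdot\bigl((x_2\cdots x_{n-1})\circ x_n\bigr)\quad(n\ge 3),$$ where $x_i\cdots x_j$ denotes the iterated product $x_i\cdot x_{i+1}\cdot\ldots\cdot x_j$. A $2$-infinitesimal nonunital bialgebra is a $2$-ass algebra $A$ with a coassociative coproduct $\Delta:A\to A\otimes A$, $\Delta(x)=\sum x_{(1)}\otimes x_{(2)}$, such that for $*\in\{\cdot,\circ\}$ and all $x,y\in A$ $$\Delta(x*y)=\sum (x*y_{(1)})\otimes y_{(2)}+\sum x_{(1)}\otimes(x_{(2)}*y)+x\otimes y.$$ Put $\mathrm{Prim}(A)=\{x:\Delta(x)=0\}$;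 it is closed under the operations $\mu_n$ and so is a $\mathrm{Mag}(\infty)$ algebra. $A$ is connected if $A=\bigcup_{p\ge1}F_p$, where $F_1=\mathrm{Prim}(A)$ and $F_p=\{x:\Delta(x)\in F_{p-1}\otimes F_{p-1}\}$ for $p\ge 2$. For a set $E$ let $2\text{-ass}(E)$ be the free $2$-ass algebra on $E$, with the coproduct that makes it a $2$-infinitesimal nonunital bialgebra in which the elements of $E$ are primitive. For a $\mathrm{Mag}(\infty)$ algebra $(M,\mu_n)$ let $U_{2\text{-ass}}(M)$ be the quotient of the free $2$-ass algebra on the vector space $M$, whose own operations as above are denoted $\overline\mu_n$, by the two-sided ideal generated by all elements $\overline\mu_n(x_1,\dots,x_n)-\mu_n(x_1,\dots,x_n)$ with $n\ge2$, $x_1,\dots,x_n\in M$; it is a $2$-infinitesimal nonunital bialgebra for the coproduct that vanishes on the image of $M$. Theorem. (a) Let $A$ be a connected $2$-infinitesimal nonunital bialgebra. Then $A$ is isomorphic, as a $2$-infinitesimal nonunital bialgebra, to $U_{2\text{-ass}}(\mathrm{Prim}(A))$, by an isomorphism $U_{2\text{-ass}}(\mathrm{Prim}(A))\to A$ that extends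 the inclusion $\mathrm{Prim}(A)\subseteq A$. (b) Let $M$ be a $\mathrm{Mag}(\infty)$ algebra. Then the canonical map $M\to U_{2\text{-ass}}(M)$ induces an isomorphism of $\mathrm{Mag}(\infty)$ algebras $M\cong\mathrm{Prim}(U_{2\text{-ass}}(M))$. (c) For every set $E$, the $\mathrm{Mag}(\infty)$ algebra $\mathrm{Prim}(2\text{-ass}(E))$ is the free $\mathrm{Mag}(\infty)$ algebra on $E$: every map from $E$ to a $\mathrm{Mag}(\infty)$ algebra $N$ extends uniquely to a morphism of $\mathrm{Mag}(\infty)$ algebras $\mathrm{Prim}(2\text{-ass}(E))\to N$. -/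

import Mathlib

open scoped TensorProduct

universe u v w x y

noncomputable section

namespace TwoInf

/-! ### Algebras with two associative products, and Mag(∞) algebras -/

/-- A `2-ass` algebra over `K`: a vector space with two associative bilinear products
`dot` (written `x · y` in comments) and `circ` (written `x ∘ y`). -/
class TwoAss (K : Type*) (A : Type*) [Field K] [AddCommGroup A] [Module K A] where
  dot : A →ₗ[K] A →ₗ[K] A
  circ : A →ₗ[K] A →ₗ[K] A
  dot_assoc : ∀ x y z : A, dot (dot x y) z = dot x (dot y z)
  circ_assoc : ∀ x y z : A, circ (circ x y) z = circ x (circ y z)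

/-- A `Mag(∞)` algebra over `K`: a vector space with one `n`-linear operation for each `n ≥ 2`,
subject to no relation. Here `op n` is the operation of arity `n + 2`. -/
class MagInf (K : Type*) (M : Type*) [Field K] [AddCommGroup M] [Module K M] where
  op : (n : ℕ) → MultilinearMap K (fun _ : Fin (n + 2) => M) M

/-- `f` is a morphism of `2-ass` algebras. -/
structure IsTwoAssHom {K A B : Type*} [Field K] [AddCommGroup A] [Module K A]
    [AddCommGroup B] [Module K B] [TwoAss K A] [TwoAss K B] (f : A →ₗ[K] B) : Prop where
  map_dot : ∀ x y, f (TwoAss.dot (K := K) x y) = TwoAss.dot (K := K) (f x) (f y)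
  map_circ : ∀ x y, f (TwoAss.circ (K := K) x y) = TwoAss.circ (K := K) (f x) (f y)

/-- `f` is a morphism of `Mag(∞)` algebras. -/
def IsMagInfHom {K M N : Type*} [Field K] [AddCommGroup M] [Module K M]
    [AddCommGroup N] [Module K N] [MagInf K M] [MagInf K N] (f : M →ₗ[K] N) : Prop :=
  ∀ (n : ℕ) (x : Fin (n + 2) → M),
    f (MagInf.op (K := K) n x) = MagInf.op (K := K) n (fun i => f (x i))

section Mu

variable {K A B : Type*} [Field K] [AddCommGroup A] [Module K A] [AddCommGroup B] [Module K B]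

/-- `(x₀, x₁, …, xₙ) ↦ m(x₀, f(x₁, …, xₙ))`. -/
def consOp {n : ℕ} (m : A →ₗ[K] A →ₗ[K] A) (f : MultilinearMap K (fun _ : Fin n => A) A) :
    MultilinearMap K (fun _ : Fin (n + 1) => A) A :=
  LinearMap.uncurryLeft (M := fun _ : Fin (n + 1) => A)
    { toFun := fun x => (m x).compMultilinearMap f
      map_add' := fun x y => by ext; simp
      map_smul' := fun c x => by ext; simp }

/-- `(x₀, …, xₙ₋₁, xₙ) ↦ m(f(x₀, …, xₙ₋₁), xₙ)`. -/
def snocOp {n : ℕ} (m : A →ₗ[K] A →ₗ[K] A) (f : MultilinearMap K (fun _ : Fin n => A) A) :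
    MultilinearMap K (fun _ : Fin (n + 1) => A) A :=
  MultilinearMap.uncurryRight (M := fun _ : Fin (n + 1) => A) (m.compMultilinearMap f)

theorem consOp_apply {n : ℕ} (m : A →ₗ[K] A →ₗ[K] A)
    (f : MultilinearMap K (fun _ : Fin n => A) A) (x : Fin (n + 1) → A) :
    consOp m f x = m (x 0) (f (fun i => x i.succ)) := rfl

theorem snocOp_apply {n : ℕ} (m : A →ₗ[K] A →ₗ[K] A)
    (f : MultilinearMap K (fun _ : Fin n => A) A) (x : Fin (n + 1) → A) :
    snocOp m f x = m (f (fun i => x i.castSucc)) (x (Fin.last n)) := rfl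

variable (K A) [TwoAss K A] [TwoAss K B]

/-- The right-bracketed product `(x₀, …, xₙ) ↦ x₀ · (x₁ · (⋯ · xₙ))`. -/
def dotProd : (n : ℕ) → MultilinearMap K (fun _ : Fin (n + 1) => A) A
  | 0 => MultilinearMap.ofSubsingleton K A A (0 : Fin 1) LinearMap.id
  | n + 1 => consOp TwoAss.dot (dotProd n)

/-- `(x₀, …, xₙ, xₙ₊₁) ↦ (x₀ · (x₁ · (⋯ · xₙ))) ∘ xₙ₊₁`. -/
def dotCirc (n : ℕ) : MultilinearMap K (fun _ : Fin (n + 2) => A) A :=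
  snocOp TwoAss.circ (dotProd K A n)

/-- The operations of a `2-ass` algebra: `mu n` has arity `n + 2`,
`μ₂(x₁, x₂) = x₁ · x₂ - x₁ ∘ x₂` and, for `n ≥ 3`,
`μₙ(x₁, …, xₙ) = (x₁ · (⋯ · xₙ₋₁)) ∘ xₙ - x₁ · ((x₂ · (⋯ · xₙ₋₁)) ∘ xₙ)`. -/
def mu : (n : ℕ) → MultilinearMap K (fun _ : Fin (n + 2) => A) A
  | 0 => dotProd K A 1 - dotCirc K A 0
  | n + 1 => dotCirc K A (n + 1) - consOp TwoAss.dot (dotCirc K A n)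

theorem mu_zero_apply (x : Fin 2 → A) :
    mu K A 0 x = TwoAss.dot (K := K) (x 0) (x 1) - TwoAss.circ (K := K) (x 0) (x 1) := rfl

theorem mu_one_apply (x : Fin 3 → A) :
    mu K A 1 x = TwoAss.circ (K := K) (TwoAss.dot (K := K) (x 0) (x 1)) (x 2)
      - TwoAss.dot (K := K) (x 0) (TwoAss.circ (K := K) (x 1) (x 2)) := rfl

/-- For `n ≥ 1`, with `a = x₁ · (⋯ · xₙ)`: `μ(x₀, …, xₙ₊₁) = (x₀ · a) ∘ xₙ₊₁ - x₀ · (a ∘ xₙ₊₁)`. -/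
theorem mu_succ_apply (n : ℕ) (x : Fin (n + 3) → A) :
    mu K A (n + 1) x =
      TwoAss.circ (K := K) (TwoAss.dot (K := K) (x 0)
        (dotProd K A n (fun i => x i.castSucc.succ))) (x (Fin.last (n + 2)))
      - TwoAss.dot (K := K) (x 0) (TwoAss.circ (K := K)
          (dotProd K A n (fun i => x i.castSucc.succ)) (x (Fin.last (n + 2)))) := rfl

variable {K A}

theorem IsTwoAssHom.map_dotProd {f : A →ₗ[K] B} (hf : IsTwoAssHom f) :
    ∀ (n : ℕ) (x : Fin (n + 1) → A), f (dotProd K A n x) = dotProd K B n (fun i => f (x i))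
  | 0, _ => rfl
  | n + 1, x => by
      rw [dotProd, dotProd, consOp_apply, consOp_apply, hf.map_dot, hf.map_dotProd n]

theorem IsTwoAssHom.map_mu {f : A →ₗ[K] B} (hf : IsTwoAssHom f) (n : ℕ) (x : Fin (n + 2) → A) :
    f (mu K A n x) = mu K B n (fun i => f (x i)) := by
  cases n with
  | zero => simp only [mu_zero_apply, map_sub, hf.map_dot, hf.map_circ]
  | succ n => simp only [mu_succ_apply, map_sub, hf.map_dot, hf.map_circ, hf.map_dotProd]

end Mu

/-! ### 2-infinitesimal nonunital bialgebras, primitive elements, connectedness -/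

/-- `Δ` satisfies the nonunital infinitesimal relation with the product `m`:
`Δ(m(x, y)) = ∑ m(x, y₍₁₎) ⊗ y₍₂₎ + ∑ x₍₁₎ ⊗ m(x₍₂₎, y) + x ⊗ y`. -/
def IsInfinitesimal {K A : Type*} [Field K] [AddCommGroup A] [Module K A]
    (m : A →ₗ[K] A →ₗ[K] A) (Δ : A →ₗ[K] A ⊗[K] A) : Prop :=
  ∀ x y : A, Δ (m x y) = (m x).rTensor A (Δ y) + (m.flip y).lTensor A (Δ x) + x ⊗ₜ[K] y

/-- A 2-infinitesimal nonunital bialgebra: a `2-ass` algebra with a coassociative coproduct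
(no counit) satisfying the nonunital infinitesimal relation with both products. -/
class TwoInfBialgebra (K : Type*) (A : Type*) [Field K] [AddCommGroup A] [Module K A]
    extends TwoAss K A where
  comul : A →ₗ[K] A ⊗[K] A
  coassoc : ∀ x : A, TensorProduct.assoc K A A A (comul.rTensor A (comul x)) =
    comul.lTensor A (comul x)
  comul_dot : IsInfinitesimal dot comul
  comul_circ : IsInfinitesimal circ comul

/-- `f` is a morphism of 2-infinitesimal nonunital bialgebras. -/
structure IsTwoInfBialgebraHom {K A B : Type*} [Field K] [AddCommGroup A] [Module K A]
    [AddCommGroup B] [Module K B] [TwoInfBialgebra K A] [TwoInfBialgebra K B]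
    (f : A →ₗ[K] B) : Prop extends IsTwoAssHom f where
  map_comul : ∀ x, TwoInfBialgebra.comul (K := K) (f x) =
    TensorProduct.map f f (TwoInfBialgebra.comul (K := K) x)

section Bialgebra

variable (K : Type*) (A : Type*) [Field K] [AddCommGroup A] [Module K A]

/-- The subspace of primitive elements, `Prim(A) = {x | Δ(x) = 0}`. -/
def Prim [TwoInfBialgebra K A] : Submodule K A :=
  LinearMap.ker (TwoInfBialgebra.comul (K := K) (A := A))

/-- The filtration `F₁ = Prim(A)`, `Fₚ = {x | Δ(x) ∈ Fₚ₋₁ ⊗ Fₚ₋₁}`; here `primFiltration p` is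
`Fₚ₊₁`, and `F ⊗ F` is the span in `A ⊗ A` of the pure tensors of elements of `F`. -/
def primFiltration [TwoInfBialgebra K A] : ℕ → Submodule K A
  | 0 => Prim K A
  | p + 1 => Submodule.comap (TwoInfBialgebra.comul (K := K) (A := A))
      (Submodule.map₂ (TensorProduct.mk K A A) (primFiltration p) (primFiltration p))

/-- `A` is connected: it is the union of the filtration `F₁ ⊆ F₂ ⊆ ⋯`. -/
def IsConnected [TwoInfBialgebra K A] : Prop :=
  ∀ x : A, ∃ p : ℕ, x ∈ primFiltration K A p

end Bialgebra

/-! ### The auxiliary `2-ass` algebra `A ⊕ (A ⊗ A)`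

A linear map `Δ : A → A ⊗ A` satisfies both infinitesimal relations if and only if
`x ↦ (x, Δ x)` is a morphism of `2-ass` algebras into `A ⊕ (A ⊗ A)` with the products below.
This is used to define coproducts on free algebras and on their quotients. -/

section Ext

variable {K A : Type*} [Field K] [AddCommGroup A] [Module K A]

/-- `(a, s)(b, t) = (ab, a t + s b + a ⊗ b)`. -/
def extMul (m : A →ₗ[K] A →ₗ[K] A) :
    (A × (A ⊗[K] A)) →ₗ[K] (A × (A ⊗[K] A)) →ₗ[K] (A × (A ⊗[K] A)) :=
  LinearMap.mk₂ K
    (fun p q => (m p.1 q.1,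
      (m p.1).rTensor A q.2 + (m.flip q.1).lTensor A p.2 + p.1 ⊗ₜ[K] q.1))
    (fun p p' q => by
      ext1
      · simp
      · simp only [Prod.fst_add, Prod.snd_add, map_add, LinearMap.rTensor_add,
          LinearMap.add_apply, TensorProduct.add_tmul]
        abel)
    (fun c p q => by
      ext1
      · simp
      · simp only [Prod.smul_fst, Prod.smul_snd, map_smul, LinearMap.rTensor_smul,
          LinearMap.smul_apply, TensorProduct.smul_tmul', smul_add])
    (fun p q q' => by
      ext1
      · simp
      · simp only [Prod.fst_add, Prod.snd_add, map_add, LinearMap.lTensor_add,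
          LinearMap.add_apply, TensorProduct.tmul_add]
        abel)
    (fun c p q => by
      ext1
      · simp
      · simp only [Prod.smul_fst, Prod.smul_snd, map_smul, LinearMap.lTensor_smul,
          LinearMap.smul_apply, TensorProduct.tmul_smul, smul_add])

theorem extMul_fst (m : A →ₗ[K] A →ₗ[K] A) (p q : A × (A ⊗[K] A)) :
    (extMul m p q).1 = m p.1 q.1 := rfl

theorem extMul_snd (m : A →ₗ[K] A →ₗ[K] A) (p q : A × (A ⊗[K] A)) :
    (extMul m p q).2 = (m p.1).rTensor A q.2 + (m.flip q.1).lTensor A p.2 + p.1 ⊗ₜ[K] q.1 := rfl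

theorem rTensor_rTensor_of {m : A →ₗ[K] A →ₗ[K] A}
    (h : ∀ x y z, m (m x y) z = m x (m y z)) (x y : A) (t : A ⊗[K] A) :
    (m (m x y)).rTensor A t = (m x).rTensor A ((m y).rTensor A t) := by
  induction t with
  | zero => simp
  | tmul a b => simp [h]
  | add s t hs ht => simp only [map_add, hs, ht]

theorem lTensor_lTensor_of {m : A →ₗ[K] A →ₗ[K] A}
    (h : ∀ x y z, m (m x y) z = m x (m y z)) (x y : A) (t : A ⊗[K] A) :
    (m.flip (m x y)).lTensor A t = (m.flip y).lTensor A ((m.flip x).lTensor A t) := by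
  induction t with
  | zero => simp
  | tmul a b => simp [h]
  | add s t hs ht => simp only [map_add, hs, ht]

theorem rTensor_lTensor_comm (f g : A →ₗ[K] A) (t : A ⊗[K] A) :
    f.rTensor A (g.lTensor A t) = g.lTensor A (f.rTensor A t) := by
  rw [← LinearMap.comp_apply, ← LinearMap.comp_apply, LinearMap.rTensor_comp_lTensor,
    LinearMap.lTensor_comp_rTensor]

theorem extMul_assoc {m : A →ₗ[K] A →ₗ[K] A}
    (h : ∀ x y z, m (m x y) z = m x (m y z)) (p q r : A × (A ⊗[K] A)) :
    extMul m (extMul m p q) r = extMul m p (extMul m q r) := by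
  ext1
  · simp only [extMul_fst, h]
  · simp only [extMul_fst, extMul_snd, map_add, rTensor_rTensor_of h, lTensor_lTensor_of h,
      LinearMap.lTensor_tmul, LinearMap.rTensor_tmul, LinearMap.flip_apply, rTensor_lTensor_comm]
    abel

instance extTwoAss [TwoAss K A] : TwoAss K (A × (A ⊗[K] A)) where
  dot := extMul TwoAss.dot
  circ := extMul TwoAss.circ
  dot_assoc := extMul_assoc TwoAss.dot_assoc
  circ_assoc := extMul_assoc TwoAss.circ_assoc

theorem ext_dot [TwoAss K A] (p q : A × (A ⊗[K] A)) :
    TwoAss.dot (K := K) p q = extMul TwoAss.dot p q := rfl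

theorem ext_circ [TwoAss K A] (p q : A × (A ⊗[K] A)) :
    TwoAss.circ (K := K) p q = extMul TwoAss.circ p q := rfl

theorem fst_isTwoAssHom [TwoAss K A] :
    IsTwoAssHom (LinearMap.fst K A (A ⊗[K] A)) :=
  ⟨fun _ _ => rfl, fun _ _ => rfl⟩

theorem mu_ext_snd [TwoAss K A] (n : ℕ) (x : Fin (n + 2) → A × (A ⊗[K] A))
    (hx : ∀ i, (x i).2 = 0) : (mu K (A × (A ⊗[K] A)) n x).2 = 0 := by
  cases n with
  | zero =>
      simp only [mu_zero_apply, Prod.snd_sub, ext_dot, ext_circ, extMul_snd, hx, map_zero]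
      abel
  | succ n =>
      simp only [mu_succ_apply, Prod.snd_sub, ext_dot, ext_circ, extMul_snd, extMul_fst, hx,
        map_zero, map_add, LinearMap.lTensor_tmul, LinearMap.rTensor_tmul, LinearMap.flip_apply,
        rTensor_lTensor_comm]
      abel

theorem mu_ext [TwoAss K A] (n : ℕ) (x : Fin (n + 2) → A) :
    mu K (A × (A ⊗[K] A)) n (fun i => (x i, 0)) = (mu K A n x, 0) := by
  ext1
  · exact fst_isTwoAssHom.map_mu n _
  · exact mu_ext_snd n _ (fun _ => rfl)

theorem isTwoAssHom_comul [TwoInfBialgebra K A] :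
    IsTwoAssHom (LinearMap.prod (LinearMap.id : A →ₗ[K] A) TwoInfBialgebra.comul) :=
  ⟨fun x y => Prod.ext rfl (TwoInfBialgebra.comul_dot x y),
   fun x y => Prod.ext rfl (TwoInfBialgebra.comul_circ x y)⟩

/-- The primitive elements are closed under the operations `μₙ`. -/
theorem mu_mem_Prim [TwoInfBialgebra K A] (n : ℕ) (x : Fin (n + 2) → A)
    (hx : ∀ i, x i ∈ Prim K A) : mu K A n x ∈ Prim K A := by
  have h := (isTwoAssHom_comul (K := K) (A := A)).map_mu n x
  exact (congrArg Prod.snd h).trans (mu_ext_snd n _ hx)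

/-- `Prim(A)` is a `Mag(∞)` algebra under the restrictions of the operations `μₙ`. -/
instance primMagInf [TwoInfBialgebra K A] : MagInf K (Prim K A) where
  op n := ((mu K A n).compLinearMap (fun _ => (Prim K A).subtype)).codRestrict (Prim K A)
    (fun x => mu_mem_Prim n _ (fun i => (x i).2))

theorem coe_prim_op [TwoInfBialgebra K A] (n : ℕ) (x : Fin (n + 2) → Prim K A) :
    ((MagInf.op (K := K) n x : Prim K A) : A) = mu K A n (fun i => (x i : A)) := rfl

/-- The map `Ψ(s, y₁ ⊗ y₂) = ∑ s₁ ⊗ m(s₂, y₁) ⊗ y₂`. -/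
def midMul (m : A →ₗ[K] A →ₗ[K] A) (s : A ⊗[K] A) : A ⊗[K] A →ₗ[K] A ⊗[K] (A ⊗[K] A) :=
  (TensorProduct.assoc K A A A).toLinearMap ∘ₗ
    LinearMap.rTensor A ((LinearMap.lTensorHom A ∘ₗ m.flip).flip s)

theorem midMul_tmul (m : A →ₗ[K] A →ₗ[K] A) (s : A ⊗[K] A) (a b : A) :
    midMul m s (a ⊗ₜ b) = TensorProduct.assoc K A A A ((m.flip a).lTensor A s ⊗ₜ b) := rfl

theorem midMul_add (m : A →ₗ[K] A →ₗ[K] A) (s s' t : A ⊗[K] A) :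
    midMul m (s + s') t = midMul m s t + midMul m s' t := by
  simp [midMul]

theorem midMul_zero (m : A →ₗ[K] A →ₗ[K] A) (t : A ⊗[K] A) : midMul m 0 t = 0 := by
  simp [midMul]

theorem midMul_tmul_left (m : A →ₗ[K] A →ₗ[K] A) (a b : A) (t : A ⊗[K] A) :
    midMul m (a ⊗ₜ b) t = a ⊗ₜ (m b).rTensor A t := by
  induction t with
  | zero => simp
  | tmul c d => simp [midMul_tmul]
  | add s t hs ht => simp only [map_add, hs, ht, TensorProduct.tmul_add]

theorem coassoc_left_aux {m : A →ₗ[K] A →ₗ[K] A} {Δ : A →ₗ[K] A ⊗[K] A}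
    (h : IsInfinitesimal m Δ) (x : A) (t : A ⊗[K] A) :
    TensorProduct.assoc K A A A (Δ.rTensor A ((m x).rTensor A t)) =
      (m x).rTensor (A ⊗[K] A) (TensorProduct.assoc K A A A (Δ.rTensor A t))
        + midMul m (Δ x) t + x ⊗ₜ t := by
  induction t with
  | zero => simp
  | tmul a b =>
      simp only [LinearMap.rTensor_tmul, h x a, TensorProduct.add_tmul, map_add, midMul_tmul,
        TensorProduct.assoc_tmul]
      congr 2
      generalize Δ a = s
      induction s with
      | zero => simp
      | tmul c d => simp
      | add s t hs ht => simp only [map_add, TensorProduct.add_tmul, hs, ht]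
  | add s t hs ht =>
      simp only [map_add, hs, ht, TensorProduct.tmul_add]
      abel

theorem coassoc_right_aux {m : A →ₗ[K] A →ₗ[K] A} {Δ : A →ₗ[K] A ⊗[K] A}
    (h : IsInfinitesimal m Δ) (y : A) (s : A ⊗[K] A) :
    Δ.lTensor A ((m.flip y).lTensor A s) =
      ((m.flip y).lTensor A).lTensor A (Δ.lTensor A s)
        + midMul m s (Δ y) + TensorProduct.assoc K A A A (s ⊗ₜ y) := by
  induction s with
  | zero => simp [midMul_zero]
  | tmul a b =>
      simp only [LinearMap.lTensor_tmul, LinearMap.flip_apply, h b y, TensorProduct.tmul_add,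
        midMul_tmul_left, TensorProduct.assoc_tmul]
      abel
  | add s t hs ht =>
      simp only [map_add, hs, ht, midMul_add, TensorProduct.add_tmul]
      abel

theorem coassoc_mul {m : A →ₗ[K] A →ₗ[K] A} {Δ : A →ₗ[K] A ⊗[K] A}
    (h : IsInfinitesimal m Δ) {x y : A}
    (hx : TensorProduct.assoc K A A A (Δ.rTensor A (Δ x)) = Δ.lTensor A (Δ x))
    (hy : TensorProduct.assoc K A A A (Δ.rTensor A (Δ y)) = Δ.lTensor A (Δ y)) :
    TensorProduct.assoc K A A A (Δ.rTensor A (Δ (m x y))) = Δ.lTensor A (Δ (m x y)) := by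
  have h1 : ∀ t : A ⊗[K] A, Δ.lTensor A ((m x).rTensor A t) =
      (m x).rTensor (A ⊗[K] A) (Δ.lTensor A t) := fun t => by
    rw [← LinearMap.comp_apply, ← LinearMap.comp_apply, LinearMap.rTensor_comp_lTensor,
      LinearMap.lTensor_comp_rTensor]
  have h2 : ∀ s : A ⊗[K] A, TensorProduct.assoc K A A A
      (Δ.rTensor A ((m.flip y).lTensor A s)) =
      ((m.flip y).lTensor A).lTensor A (TensorProduct.assoc K A A A (Δ.rTensor A s)) := fun s => by
    induction s with
    | zero => simp
    | tmul a b =>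
        simp only [LinearMap.lTensor_tmul, LinearMap.rTensor_tmul]
        generalize Δ a = u
        induction u with
        | zero => simp
        | tmul c d => simp
        | add s t hs ht => simp only [map_add, TensorProduct.add_tmul, hs, ht]
    | add s t hs ht => simp only [map_add, hs, ht]
  rw [h x y]
  simp only [map_add, h1, h2, coassoc_left_aux h, coassoc_right_aux h, hx, hy,
    LinearMap.rTensor_tmul, LinearMap.lTensor_tmul]
  abel

end Ext

/-! ### Ideals and quotients of `2-ass` algebras -/

section Ideal

variable {K A B : Type*} [Field K] [AddCommGroup A] [Module K A] [TwoAss K A]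
  [AddCommGroup B] [Module K B] [TwoAss K B]

/-- A two-sided ideal of a `2-ass` algebra. -/
structure IsIdeal (I : Submodule K A) : Prop where
  dot_left : ∀ a, ∀ x ∈ I, TwoAss.dot (K := K) a x ∈ I
  dot_right : ∀ x ∈ I, ∀ a, TwoAss.dot (K := K) x a ∈ I
  circ_left : ∀ a, ∀ x ∈ I, TwoAss.circ (K := K) a x ∈ I
  circ_right : ∀ x ∈ I, ∀ a, TwoAss.circ (K := K) x a ∈ I

variable (K) in
/-- The ideal generated by a set. -/
def idealSpan (S : Set A) : Submodule K A :=
  sInf {I : Submodule K A | IsIdeal I ∧ S ⊆ I}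

theorem idealSpan_le {S : Set A} {I : Submodule K A} (hI : IsIdeal I) (h : S ⊆ I) :
    idealSpan K S ≤ I := sInf_le ⟨hI, h⟩

theorem subset_idealSpan (S : Set A) : S ⊆ idealSpan K S := fun x hx => by
  simp only [idealSpan, SetLike.mem_coe, Submodule.mem_sInf]
  exact fun I hI => hI.2 hx

theorem isIdeal_idealSpan (S : Set A) : IsIdeal (idealSpan K S) := by
  constructor <;> simp only [idealSpan, Submodule.mem_sInf]
  · exact fun a x hx I hI => hI.1.dot_left a x (hx I hI)
  · exact fun x hx a I hI => hI.1.dot_right x (hx I hI) a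
  · exact fun a x hx I hI => hI.1.circ_left a x (hx I hI)
  · exact fun x hx a I hI => hI.1.circ_right x (hx I hI) a

/-- The bilinear product induced on the quotient by an ideal. -/
def quotMul (I : Submodule K A) (m : A →ₗ[K] A →ₗ[K] A)
    (hl : ∀ a, ∀ x ∈ I, m a x ∈ I) (hr : ∀ x ∈ I, ∀ a, m x a ∈ I) :
    (A ⧸ I) →ₗ[K] (A ⧸ I) →ₗ[K] (A ⧸ I) :=
  I.liftQ
    { toFun := fun a => I.mapQ I (m a) (hl a)
      map_add' := fun a b => by ext; simp
      map_smul' := fun c a => by ext; simp }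
    (fun x hx => by
      rw [LinearMap.mem_ker]
      ext a
      simpa using (Submodule.Quotient.mk_eq_zero I).2 (hr x hx a))

instance quotTwoAss (S : Set A) : TwoAss K (A ⧸ idealSpan K S) where
  dot := quotMul _ TwoAss.dot (isIdeal_idealSpan S).dot_left (isIdeal_idealSpan S).dot_right
  circ := quotMul _ TwoAss.circ (isIdeal_idealSpan S).circ_left (isIdeal_idealSpan S).circ_right
  dot_assoc := by
    rintro ⟨x⟩ ⟨y⟩ ⟨z⟩
    exact congrArg (Submodule.Quotient.mk) (TwoAss.dot_assoc x y z)
  circ_assoc := by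
    rintro ⟨x⟩ ⟨y⟩ ⟨z⟩
    exact congrArg (Submodule.Quotient.mk) (TwoAss.circ_assoc x y z)

theorem mkQ_isTwoAssHom (S : Set A) : IsTwoAssHom (idealSpan K S).mkQ :=
  ⟨fun _ _ => rfl, fun _ _ => rfl⟩

theorem isIdeal_ker {f : A →ₗ[K] B} (hf : IsTwoAssHom f) : IsIdeal (LinearMap.ker f) := by
  constructor <;> simp only [LinearMap.mem_ker]
  · intro a x hx; rw [hf.map_dot, hx, map_zero]
  · intro x hx a; rw [hf.map_dot, hx, map_zero, LinearMap.zero_apply]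
  · intro a x hx; rw [hf.map_circ, hx, map_zero]
  · intro x hx a; rw [hf.map_circ, hx, map_zero, LinearMap.zero_apply]

theorem liftQ_isTwoAssHom (S : Set A) {f : A →ₗ[K] B} (hf : IsTwoAssHom f)
    (h : idealSpan K S ≤ LinearMap.ker f) : IsTwoAssHom ((idealSpan K S).liftQ f h) := by
  constructor
  · rintro ⟨x⟩ ⟨y⟩; exact hf.map_dot x y
  · rintro ⟨x⟩ ⟨y⟩; exact hf.map_circ x y

/-- The range of `g` generates `A` as a `2-ass` algebra. -/
def Generates {X : Type*} (K : Type*) {A : Type*} [Field K] [AddCommGroup A] [Module K A]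
    [TwoAss K A] (g : X → A) : Prop :=
  ∀ P : Submodule K A, (∀ x, g x ∈ P) →
    (∀ x ∈ P, ∀ y ∈ P, TwoAss.dot (K := K) x y ∈ P) →
    (∀ x ∈ P, ∀ y ∈ P, TwoAss.circ (K := K) x y ∈ P) → ∀ a, a ∈ P

theorem Generates.comp_surjective {X : Type*} {g : X → A} (hg : Generates K g) {f : A →ₗ[K] B}
    (hf : IsTwoAssHom f) (hs : Function.Surjective f) : Generates K (fun x => f (g x)) := by
  intro P h1 h2 h3 b
  obtain ⟨a, rfl⟩ := hs b
  exact hg (P.comap f) h1 (fun x hx y hy => by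
      simpa only [Submodule.mem_comap, hf.map_dot] using h2 _ hx _ hy)
    (fun x hx y hy => by
      simpa only [Submodule.mem_comap, hf.map_circ] using h3 _ hx _ hy) a

theorem Generates.id_of_hom {X : Type*} {g : X → A} (hg : Generates K g) {f : A →ₗ[K] A}
    (hf : IsTwoAssHom f) (h : ∀ x, f (g x) = g x) (a : A) : f a = a :=
  hg (LinearMap.eqLocus f LinearMap.id) h
    (fun x hx y hy => by
      simp only [LinearMap.mem_eqLocus, LinearMap.id_apply] at hx hy ⊢
      rw [hf.map_dot, hx, hy])
    (fun x hx y hy => by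
      simp only [LinearMap.mem_eqLocus, LinearMap.id_apply] at hx hy ⊢
      rw [hf.map_circ, hx, hy]) a

theorem IsTwoAssHom.comp {C : Type*} [AddCommGroup C] [Module K C] [TwoAss K C]
    {g : B →ₗ[K] C} {f : A →ₗ[K] B} (hg : IsTwoAssHom g) (hf : IsTwoAssHom f) :
    IsTwoAssHom (g ∘ₗ f) :=
  ⟨fun x y => by simp only [LinearMap.comp_apply, hf.map_dot, hg.map_dot],
   fun x y => by simp only [LinearMap.comp_apply, hf.map_circ, hg.map_circ]⟩

/-- If `A` is generated by the range of `g` and `δ : A → A ⊕ (A ⊗ A)` is a morphism of `2-ass`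
algebras with `δ(g x) = (g x, 0)`, then the second component of `δ` is a coproduct which makes `A`
a 2-infinitesimal nonunital bialgebra in which every `g x` is primitive. -/
@[reducible] def bialgebraOfHom {X : Type*} (g : X → A) (hg : Generates K g)
    (δ : A →ₗ[K] A × (A ⊗[K] A)) (hδ : IsTwoAssHom δ) (h : ∀ x, δ (g x) = (g x, 0)) :
    TwoInfBialgebra K A :=
  have h1 : ∀ a, (δ a).1 = a := hg.id_of_hom (fst_isTwoAssHom.comp hδ)
    (fun x => congrArg Prod.fst (h x))
  have hd : IsInfinitesimal TwoAss.dot (LinearMap.snd K A (A ⊗[K] A) ∘ₗ δ) := fun x y => by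
    simp only [LinearMap.comp_apply, LinearMap.snd_apply, hδ.map_dot, ext_dot, extMul_snd, h1]
  have hc : IsInfinitesimal TwoAss.circ (LinearMap.snd K A (A ⊗[K] A) ∘ₗ δ) := fun x y => by
    simp only [LinearMap.comp_apply, LinearMap.snd_apply, hδ.map_circ, ext_circ, extMul_snd, h1]
  { comul := LinearMap.snd K A (A ⊗[K] A) ∘ₗ δ
    coassoc := fun a => by
      have := hg (LinearMap.eqLocus
        ((TensorProduct.assoc K A A A).toLinearMap ∘ₗ
          (LinearMap.snd K A (A ⊗[K] A) ∘ₗ δ).rTensor A ∘ₗ (LinearMap.snd K A (A ⊗[K] A) ∘ₗ δ))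
        ((LinearMap.snd K A (A ⊗[K] A) ∘ₗ δ).lTensor A ∘ₗ (LinearMap.snd K A (A ⊗[K] A) ∘ₗ δ)))
        (fun x => by simp [LinearMap.mem_eqLocus, h])
        (fun x hx y hy => coassoc_mul hd hx hy)
        (fun x hx y hy => coassoc_mul hc hx hy) a
      exact this
    comul_dot := hd
    comul_circ := hc }

end Ideal

/-! ### The free `2-ass` algebra on a set -/

/-- Formal expressions in two binary operations on the letters `E`. -/
inductive Term (E : Type*) where
  | leaf : E → Term E
  | dot : Term E → Term E → Term E
  | circ : Term E → Term E → Term E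

/-- The elementary rewritings generated by associativity of both operations. -/
inductive Term.Rel {E : Type*} : Term E → Term E → Prop
  | dot_assoc (a b c) : Rel (.dot (.dot a b) c) (.dot a (.dot b c))
  | circ_assoc (a b c) : Rel (.circ (.circ a b) c) (.circ a (.circ b c))
  | dot_left {a a'} (b) : Rel a a' → Rel (.dot a b) (.dot a' b)
  | dot_right (a) {b b'} : Rel b b' → Rel (.dot a b) (.dot a b')
  | circ_left {a a'} (b) : Rel a a' → Rel (.circ a b) (.circ a' b)
  | circ_right (a) {b b'} : Rel b b' → Rel (.circ a b) (.circ a b')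

/-- The free set with two associative operations on `E`. -/
def Word (E : Type*) : Type _ := Quot (Term.Rel (E := E))

namespace Word

variable {E : Type*}

def leaf (e : E) : Word E := Quot.mk _ (.leaf e)

def dot : Word E → Word E → Word E :=
  Quot.map₂ Term.dot (fun a _ _ h => .dot_right a h) (fun _ _ b h => .dot_left b h)

def circ : Word E → Word E → Word E :=
  Quot.map₂ Term.circ (fun a _ _ h => .circ_right a h) (fun _ _ b h => .circ_left b h)

theorem dot_assoc (a b c : Word E) : dot (dot a b) c = dot a (dot b c) := by
  induction a using Quot.ind
  induction b using Quot.ind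
  induction c using Quot.ind
  exact Quot.sound (.dot_assoc _ _ _)

theorem circ_assoc (a b c : Word E) : circ (circ a b) c = circ a (circ b c) := by
  induction a using Quot.ind
  induction b using Quot.ind
  induction c using Quot.ind
  exact Quot.sound (.circ_assoc _ _ _)

end Word

/-- The free `2-ass` algebra on the set `E`: the vector space with basis `Word E`. -/
def FreeTwoAss (K : Type*) (E : Type*) [Field K] : Type _ := Word E →₀ K

section Free

variable (K : Type*) {E : Type*} [Field K]

instance : AddCommGroup (FreeTwoAss K E) := inferInstanceAs (AddCommGroup (Word E →₀ K))

instance : Module K (FreeTwoAss K E) := inferInstanceAs (Module K (Word E →₀ K))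

/-- The basis vector of a word. -/
def single (w : Word E) : FreeTwoAss K E := Finsupp.single w 1

variable {K}

/-- The linear extension of a function on words. -/
def linExt {B : Type*} [AddCommGroup B] [Module K B] (f : Word E → B) : FreeTwoAss K E →ₗ[K] B :=
  Finsupp.linearCombination K f

theorem linExt_single {B : Type*} [AddCommGroup B] [Module K B] (f : Word E → B) (w : Word E) :
    linExt f (single K w) = f w :=
  (Finsupp.linearCombination_single K 1 w).trans (one_smul K _)

theorem free_hom_ext {B : Type*} [AddCommGroup B] [Module K B] {f g : FreeTwoAss K E →ₗ[K] B}
    (h : ∀ w, f (single K w) = g (single K w)) : f = g :=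
  Finsupp.lhom_ext' fun w => LinearMap.ext_ring (h w)

/-- The bilinear extension of a binary operation on words. -/
def bilinExt (m : Word E → Word E → Word E) :
    FreeTwoAss K E →ₗ[K] FreeTwoAss K E →ₗ[K] FreeTwoAss K E :=
  linExt fun a => linExt fun b => single K (m a b)

theorem bilinExt_single (m : Word E → Word E → Word E) (a b : Word E) :
    bilinExt m (single K a) (single K b) = single K (m a b) := by
  simp only [bilinExt, linExt_single]

theorem bilinExt_assoc {m : Word E → Word E → Word E}
    (h : ∀ a b c, m (m a b) c = m a (m b c)) (x y z : FreeTwoAss K E) :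
    bilinExt m (bilinExt m x y) z = bilinExt m x (bilinExt m y z) := by
  have h1 (a b : Word E) : bilinExt (K := K) m (bilinExt m (single K a) (single K b)) =
      bilinExt m (single K a) ∘ₗ bilinExt m (single K b) :=
    free_hom_ext fun c => by simp only [LinearMap.comp_apply, bilinExt_single, h]
  have h2 (a : Word E) (z : FreeTwoAss K E) :
      (bilinExt (K := K) m).flip z ∘ₗ bilinExt m (single K a) =
        bilinExt m (single K a) ∘ₗ (bilinExt m).flip z :=
    free_hom_ext fun b => LinearMap.congr_fun (h1 a b) z
  have h3 : (bilinExt (K := K) m).flip z ∘ₗ (bilinExt m).flip y =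
      (bilinExt m).flip (bilinExt m y z) :=
    free_hom_ext fun a => LinearMap.congr_fun (h2 a z) y
  exact LinearMap.congr_fun h3 x

instance : TwoAss K (FreeTwoAss K E) where
  dot := bilinExt Word.dot
  circ := bilinExt Word.circ
  dot_assoc := bilinExt_assoc Word.dot_assoc
  circ_assoc := bilinExt_assoc Word.circ_assoc

theorem single_dot (a b : Word E) :
    TwoAss.dot (K := K) (single K a) (single K b) = single K (Word.dot a b) :=
  bilinExt_single _ a b

theorem single_circ (a b : Word E) :
    TwoAss.circ (K := K) (single K a) (single K b) = single K (Word.circ a b) :=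
  bilinExt_single _ a b

variable (K) in
/-- The generator of the free `2-ass` algebra given by `e : E`. -/
def gen (e : E) : FreeTwoAss K E := single K (Word.leaf e)

section Lift

variable {B : Type*} [AddCommGroup B] [Module K B] [TwoAss K B]

variable (K) in
def termVal (f : E → B) : Term E → B
  | .leaf e => f e
  | .dot a b => TwoAss.dot (K := K) (termVal f a) (termVal f b)
  | .circ a b => TwoAss.circ (K := K) (termVal f a) (termVal f b)

variable (K) in
def wordVal (f : E → B) : Word E → B :=
  Quot.lift (termVal K f) (fun a b h => by
    induction h with
    | dot_assoc a b c => exact TwoAss.dot_assoc _ _ _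
    | circ_assoc a b c => exact TwoAss.circ_assoc _ _ _
    | dot_left b _ ih => simp only [termVal, ih]
    | dot_right a _ ih => simp only [termVal, ih]
    | circ_left b _ ih => simp only [termVal, ih]
    | circ_right a _ ih => simp only [termVal, ih])

theorem wordVal_dot (f : E → B) (a b : Word E) :
    wordVal K f (a.dot b) = TwoAss.dot (K := K) (wordVal K f a) (wordVal K f b) := by
  induction a using Quot.ind
  induction b using Quot.ind
  rfl

theorem wordVal_circ (f : E → B) (a b : Word E) :
    wordVal K f (a.circ b) = TwoAss.circ (K := K) (wordVal K f a) (wordVal K f b) := by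
  induction a using Quot.ind
  induction b using Quot.ind
  rfl

/-- The morphism of `2-ass` algebras extending `f : E → B`. -/
def freeLift (f : E → B) : FreeTwoAss K E →ₗ[K] B := linExt (wordVal K f)

theorem freeLift_gen (f : E → B) (e : E) : freeLift f (gen K e) = f e :=
  linExt_single _ _

theorem freeLift_isTwoAssHom (f : E → B) : IsTwoAssHom (freeLift (K := K) f) := by
  constructor
  · intro x y
    have : (TwoAss.dot (K := K)).compr₂ (freeLift (K := K) f) =
        (TwoAss.dot (K := K)).compl₁₂ (freeLift (K := K) f) (freeLift (K := K) f) := by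
      refine free_hom_ext fun a => free_hom_ext fun b => ?_
      simp only [LinearMap.compr₂_apply, LinearMap.compl₁₂_apply, single_dot, freeLift,
        linExt_single, wordVal_dot]
    exact LinearMap.congr_fun (LinearMap.congr_fun this x) y
  · intro x y
    have : (TwoAss.circ (K := K)).compr₂ (freeLift (K := K) f) =
        (TwoAss.circ (K := K)).compl₁₂ (freeLift (K := K) f) (freeLift (K := K) f) := by
      refine free_hom_ext fun a => free_hom_ext fun b => ?_
      simp only [LinearMap.compr₂_apply, LinearMap.compl₁₂_apply, single_circ, freeLift,
        linExt_single, wordVal_circ]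
    exact LinearMap.congr_fun (LinearMap.congr_fun this x) y

end Lift

theorem generates_gen : Generates K (gen K (E := E)) := by
  intro P h1 h2 h3 a
  have hT : ∀ t : Term E, single K (Quot.mk _ t : Word E) ∈ P := by
    intro t
    induction t with
    | leaf e => exact h1 e
    | dot a b iha ihb => exact single_dot (K := K) (Quot.mk _ a) (Quot.mk _ b) ▸ h2 _ iha _ ihb
    | circ a b iha ihb => exact single_circ (K := K) (Quot.mk _ a) (Quot.mk _ b) ▸ h3 _ iha _ ihb
  have : P.mkQ = 0 := free_hom_ext fun w => by
    induction w using Quot.ind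
    simpa using hT _
  simpa using LinearMap.congr_fun this a

/-- The 2-infinitesimal bialgebra structure of the free `2-ass` algebra: its coproduct is the
one that vanishes on the generators. -/
instance freeBialgebra : TwoInfBialgebra K (FreeTwoAss K E) :=
  bialgebraOfHom (gen K) generates_gen (freeLift fun e => (gen K e, 0))
    (freeLift_isTwoAssHom _) (freeLift_gen _)

theorem comul_gen (e : E) : TwoInfBialgebra.comul (K := K) (gen K e) = 0 :=
  congrArg Prod.snd (freeLift_gen (K := K) (fun e : E => (gen K e, (0 : _ ⊗[K] _))) e)

variable (K) in
/-- The generator given by `e : E`, as a primitive element. -/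
def primGen (e : E) : Prim K (FreeTwoAss K E) := ⟨gen K e, comul_gen e⟩

end Free

/-! ### The free `2-ass` algebra on a vector space, and the universal enveloping algebra -/

section Env

variable (K : Type*) [Field K]

/-- The relations making the generators of `FreeTwoAss K V` depend linearly on `V`. -/
def linRel (V : Type*) [AddCommGroup V] [Module K V] : Set (FreeTwoAss K V) :=
  {z | (∃ v w : V, z = gen K (v + w) - (gen K v + gen K w)) ∨
    ∃ (c : K) (v : V), z = gen K (c • v) - c • gen K v}

/-- `2-ass(V)`, the free `2-ass` algebra on the vector space `V`. -/
abbrev FreeTwoAssOn (V : Type*) [AddCommGroup V] [Module K V] : Type _ :=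
  FreeTwoAss K V ⧸ idealSpan K (linRel K V)

/-- The linear inclusion of generators `V → 2-ass(V)`. -/
def genOn (V : Type*) [AddCommGroup V] [Module K V] : V →ₗ[K] FreeTwoAssOn K V where
  toFun v := (idealSpan K (linRel K V)).mkQ (gen K v)
  map_add' v w := by
    rw [← map_add, ← sub_eq_zero, ← map_sub, Submodule.mkQ_apply, Submodule.Quotient.mk_eq_zero]
    exact subset_idealSpan _ (Or.inl ⟨v, w, rfl⟩)
  map_smul' c v := by
    rw [RingHom.id_apply, ← map_smul, ← sub_eq_zero, ← map_sub, Submodule.mkQ_apply,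
      Submodule.Quotient.mk_eq_zero]
    exact subset_idealSpan _ (Or.inr ⟨c, v, rfl⟩)

variable {K} in
/-- The morphism of `2-ass` algebras extending a linear map `V → B`. -/
def freeOnLift {V B : Type*} [AddCommGroup V] [Module K V] [AddCommGroup B] [Module K B]
    [TwoAss K B] (f : V →ₗ[K] B) : FreeTwoAssOn K V →ₗ[K] B :=
  (idealSpan K (linRel K V)).liftQ (freeLift f)
    (idealSpan_le (isIdeal_ker (freeLift_isTwoAssHom _)) (by
      rintro z (⟨v, w, rfl⟩ | ⟨c, v, rfl⟩) <;>
      simp [freeLift_gen]))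

theorem freeOnLift_isTwoAssHom {V B : Type*} [AddCommGroup V] [Module K V] [AddCommGroup B]
    [Module K B] [TwoAss K B] (f : V →ₗ[K] B) : IsTwoAssHom (freeOnLift f) :=
  liftQ_isTwoAssHom _ (freeLift_isTwoAssHom _) _

theorem freeOnLift_genOn {V B : Type*} [AddCommGroup V] [Module K V] [AddCommGroup B]
    [Module K B] [TwoAss K B] (f : V →ₗ[K] B) (v : V) : freeOnLift f (genOn K V v) = f v :=
  freeLift_gen (K := K) f v

variable (M : Type*) [AddCommGroup M] [Module K M] [MagInf K M]

/-- The elements `μ̄ₙ(x₁, …, xₙ) - μₙ(x₁, …, xₙ)` of `2-ass(M)`, where `x₁, …, xₙ ∈ M`, `μ̄ₙ` is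
the operation of the `2-ass` algebra `2-ass(M)` and `μₙ` that of the `Mag(∞)` algebra `M`. -/
def muRel : Set (FreeTwoAssOn K M) :=
  {z | ∃ (n : ℕ) (x : Fin (n + 2) → M),
    z = mu K (FreeTwoAssOn K M) n (fun i => genOn K M (x i)) -
      genOn K M (MagInf.op (K := K) n x)}

/-- The universal enveloping `2-ass` algebra of a `Mag(∞)` algebra `M`: the quotient of `2-ass(M)`
by the ideal generated by the elements `μ̄ₙ(x₁, …, xₙ) - μₙ(x₁, …, xₙ)`. -/
def UEnv : Type _ := FreeTwoAssOn K M ⧸ idealSpan K (muRel K M)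

instance : AddCommGroup (UEnv K M) :=
  inferInstanceAs (AddCommGroup (FreeTwoAssOn K M ⧸ idealSpan K (muRel K M)))

instance : Module K (UEnv K M) :=
  inferInstanceAs (Module K (FreeTwoAssOn K M ⧸ idealSpan K (muRel K M)))

instance envTwoAss : TwoAss K (UEnv K M) :=
  inferInstanceAs (TwoAss K (FreeTwoAssOn K M ⧸ idealSpan K (muRel K M)))

/-- The canonical projection `2-ass(M) → U(M)`. -/
def envProj : FreeTwoAssOn K M →ₗ[K] UEnv K M := (idealSpan K (muRel K M)).mkQ

theorem envProj_isTwoAssHom : IsTwoAssHom (envProj K M) := mkQ_isTwoAssHom _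

theorem envProj_surjective : Function.Surjective (envProj K M) := Submodule.mkQ_surjective _

/-- The canonical map `M → U(M)`. -/
def envι : M →ₗ[K] UEnv K M := envProj K M ∘ₗ genOn K M

theorem envι_op (n : ℕ) (x : Fin (n + 2) → M) :
    envι K M (MagInf.op (K := K) n x) = mu K (UEnv K M) n (fun i => envι K M (x i)) := by
  have h := (envProj_isTwoAssHom K M).map_mu n (fun i => genOn K M (x i))
  refine Eq.trans ?_ h
  rw [envι, LinearMap.comp_apply, eq_comm, ← sub_eq_zero, ← map_sub]
  exact (Submodule.Quotient.mk_eq_zero _).2 (subset_idealSpan _ ⟨n, x, rfl⟩)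

variable {K M}

theorem muRel_subset_ker {B : Type*} [AddCommGroup B] [Module K B] [TwoAss K B]
    (f : M →ₗ[K] B)
    (hf : ∀ (n : ℕ) (x : Fin (n + 2) → M),
      f (MagInf.op (K := K) n x) = mu K B n (fun i => f (x i))) :
    muRel K M ⊆ LinearMap.ker (freeOnLift f) := by
  rintro z ⟨n, x, rfl⟩
  rw [SetLike.mem_coe, LinearMap.mem_ker, map_sub, (freeOnLift_isTwoAssHom K f).map_mu]
  simp only [freeOnLift_genOn, hf, sub_self]

/-- The morphism of `2-ass` algebras `U(M) → B` extending a linear map `f : M → B` that carries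
the operations of `M` to the operations `μₙ` of `B`. -/
def envLift {B : Type*} [AddCommGroup B] [Module K B] [TwoAss K B] (f : M →ₗ[K] B)
    (hf : ∀ (n : ℕ) (x : Fin (n + 2) → M),
      f (MagInf.op (K := K) n x) = mu K B n (fun i => f (x i))) : UEnv K M →ₗ[K] B :=
  (idealSpan K (muRel K M)).liftQ (freeOnLift f)
    (idealSpan_le (isIdeal_ker (freeOnLift_isTwoAssHom K f)) (muRel_subset_ker f hf))

theorem envLift_isTwoAssHom {B : Type*} [AddCommGroup B] [Module K B] [TwoAss K B]
    (f : M →ₗ[K] B)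
    (hf : ∀ (n : ℕ) (x : Fin (n + 2) → M),
      f (MagInf.op (K := K) n x) = mu K B n (fun i => f (x i))) : IsTwoAssHom (envLift f hf) :=
  liftQ_isTwoAssHom _ (freeOnLift_isTwoAssHom K f) _

theorem envLift_ι {B : Type*} [AddCommGroup B] [Module K B] [TwoAss K B]
    (f : M →ₗ[K] B)
    (hf : ∀ (n : ℕ) (x : Fin (n + 2) → M),
      f (MagInf.op (K := K) n x) = mu K B n (fun i => f (x i))) (m : M) :
    envLift f hf (envι K M m) = f m :=
  freeOnLift_genOn K f m

theorem generates_envι : Generates K (envι K M) :=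
  (generates_gen.comp_surjective (mkQ_isTwoAssHom (linRel K M))
    (Submodule.mkQ_surjective _)).comp_surjective
    (envProj_isTwoAssHom K M) (envProj_surjective K M)

theorem env_aux (n : ℕ) (x : Fin (n + 2) → M) :
    (LinearMap.inl K (UEnv K M) (UEnv K M ⊗[K] UEnv K M) ∘ₗ envι K M) (MagInf.op (K := K) n x) =
      mu K (UEnv K M × (UEnv K M ⊗[K] UEnv K M)) n
        (fun i => (LinearMap.inl K (UEnv K M) (UEnv K M ⊗[K] UEnv K M) ∘ₗ envι K M) (x i)) := by
  rw [LinearMap.comp_apply, envι_op]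
  exact (mu_ext n _).symm

/-- The 2-infinitesimal bialgebra structure of `U(M)`, induced by that of `2-ass(M)`: its
coproduct is the one that vanishes on the image of `M`. -/
instance envBialgebra : TwoInfBialgebra K (UEnv K M) :=
  bialgebraOfHom (envι K M) generates_envι
    (envLift (LinearMap.inl K (UEnv K M) (UEnv K M ⊗[K] UEnv K M) ∘ₗ envι K M) env_aux)
    (envLift_isTwoAssHom _ _) (envLift_ι _ _)

theorem comul_envι (m : M) : TwoInfBialgebra.comul (K := K) (envι K M m) = 0 :=
  congrArg Prod.snd
    (envLift_ι (LinearMap.inl K (UEnv K M) (UEnv K M ⊗[K] UEnv K M) ∘ₗ envι K M) env_aux m)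

end Env

end TwoInf

end

/-! The three statements follow from an explicit model of `UEnv K M` on the reduced tensor algebra
of `M`: nonempty words in a basis, with concatenation as `·` and deconcatenation as coproduct.

The relations of the enveloping algebra, solved for `∘`, say that `j ∘ i = j · i - μ(j, i)` and `(j
· w) ∘ i = j · (w ∘ i) + μ(j, w, i)` for letters `i`, `j` and a word `w`. Read as a recursion they
define right `∘`-multiplication by a letter, for arbitrary operations `μ` on `M`. The `∘`-product of
the letters of a word is the word itself plus shorter words, so the linear map `circMap` sending
each word to this product is bijective (`circMap_bijective`). Transporting concatenation along it
gives a product that is associative for free and whose right multiplication by a letter is the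
prescribed one (`circMul_letter`). The corrections `μ(...)` lie in `M`, hence are primitive, and
this makes `∘` infinitesimal for deconcatenation. By construction `M` sits inside with its own
operations (`incl_op`), and any map from `M` to a `2-ass` algebra respecting the operations extends
to words (`eval_isTwoAssHom`). Hence the word algebra is `UEnv K M` (`envEquiv`).

Deconcatenation is that of a cofree coalgebra: its kernel is `M` (`eq_incl_of_decat_eq_zero`), and
every element of the tensor square satisfying the coassociativity equation is itself a coproduct
(`decat_headCat`). The first fact is (b). For (a), the canonical map from the enveloping algebra of
`Prim K A` to `A` is injective because it is so on primitives, by induction on length. It is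
surjective by induction on the primitive filtration: the coproduct of `x` lifts to a cocycle, the
cocycle is a coproduct, and `x` differs from an element of the image by a primitive.

For (c), a map `E → N` extends to a bialgebra morphism from the free algebra to `UEnv K N`;
restricting it to primitives and applying (b) gives the extension. Uniqueness holds because the
primitives are generated by `E` (`mem_of_op_mem`). -/

noncomputable section

namespace TwoInf

/-! ### Nonempty words -/

/-- Nonempty words in the letters `I`. -/
inductive NWord (I : Type*) where
  | one : I → NWord I
  | cons : I → NWord I → NWord I

namespace NWord

variable {I : Type*}

def append : NWord I → NWord I → NWord I
  | one i, v => cons i v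
  | cons i w, v => cons i (append w v)

theorem append_assoc (a b c : NWord I) : (a.append b).append c = a.append (b.append c) := by
  induction a with
  | one i => rfl
  | cons i w ih => simp only [append, ih]

/-- The length of a word, minus one. -/
def deg : NWord I → ℕ
  | one _ => 0
  | cons _ w => deg w + 1

theorem deg_append (a b : NWord I) : (a.append b).deg = a.deg + b.deg + 1 := by
  induction a with
  | one i => simp only [append, deg]; omega
  | cons i w ih => simp only [append, deg, ih]; omega

def letters : (w : NWord I) → Fin (w.deg + 1) → I
  | one i => fun _ => i
  | cons i w => Fin.cons i w.letters

/-- Equality in the sigma type lets one `cases` replace the arity and the tuple together, with no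
transport between `Fin` types. -/
theorem exists_letters_eq (n : ℕ) (x : Fin (n + 1) → I) :
    ∃ w : NWord I, (⟨w.deg, w.letters⟩ : Σ n, Fin (n + 1) → I) = ⟨n, x⟩ := by
  induction n with
  | zero =>
      refine ⟨one (x 0), Sigma.ext rfl (heq_of_eq ?_)⟩
      funext i
      exact congrArg x (Subsingleton.elim (α := Fin 1) 0 i)
  | succ n ih =>
      obtain ⟨w, hw⟩ := ih (fun i => x i.succ)
      refine ⟨cons (x 0) w, ?_⟩
      have h : (⟨(cons (x 0) w).deg, (cons (x 0) w).letters⟩ : Σ n, Fin (n + 1) → I) =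
          (fun p : Σ n, Fin (n + 1) → I =>
            (⟨p.1 + 1, Fin.cons (x 0) p.2⟩ : Σ n, Fin (n + 1) → I)) ⟨w.deg, w.letters⟩ := rfl
      rw [h, hw]
      exact Sigma.ext rfl (heq_of_eq (Fin.cons_self_tail x))

end NWord

open NWord

/-! ### Products of letters and the operations `μ` in a `2-ass` algebra -/

section WordVal

variable {K B I : Type*} [Field K] [AddCommGroup B] [Module K B] [TwoAss K B]

variable (K) in
/-- The right-bracketed `dot` product of the values of the letters of a word. -/
def dotWord (g : I → B) : NWord I → B
  | one i => g i
  | cons i w => TwoAss.dot (K := K) (g i) (dotWord g w)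

theorem dotProd_letters (g : I → B) (w : NWord I) :
    dotProd K B w.deg (fun k => g (w.letters k)) = dotWord K g w := by
  induction w with
  | one i => rfl
  | cons i w ih => exact congrArg _ ih

theorem dotWord_append (g : I → B) (v w : NWord I) :
    dotWord K g (v.append w) = TwoAss.dot (K := K) (dotWord K g v) (dotWord K g w) := by
  induction v with
  | one i => rfl
  | cons i v ih => simp only [append, dotWord, ih, TwoAss.dot_assoc]

theorem mu_letters_one (g : I → B) (j : I) (y : B) :
    mu K B (one j).deg (Fin.snoc (α := fun _ => B) (fun k => g ((one j).letters k)) y) =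
      TwoAss.dot (K := K) (g j) y - TwoAss.circ (K := K) (g j) y :=
  rfl

/-- Solved for its first term, this is the recursion on the first letter that governs right
`∘`-multiplication, both in the definition of `circLetterWord` and in every target algebra. -/
theorem mu_letters_cons (g : I → B) (j : I) (w : NWord I) (y : B) :
    mu K B (cons j w).deg
        (Fin.snoc (α := fun _ => B) (fun k => g ((cons j w).letters k)) y) =
      TwoAss.circ (K := K) (TwoAss.dot (K := K) (g j) (dotWord K g w)) y -
        TwoAss.dot (K := K) (g j) (TwoAss.circ (K := K) (dotWord K g w) y) := by
  -- `(cons j w).deg` is `w.deg + 1` only by unfolding; an arbitrary tuple of the unfolded arity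
  -- makes the rewriting possible.
  have key (x : Fin (w.deg + 3) → B) (h0 : x 0 = g j)
      (h1 : (fun i : Fin (w.deg + 1) => x i.castSucc.succ) = fun k => g (w.letters k))
      (h2 : x (Fin.last (w.deg + 2)) = y) : mu K B (w.deg + 1) x =
      TwoAss.circ (K := K) (TwoAss.dot (K := K) (g j) (dotWord K g w)) y -
        TwoAss.dot (K := K) (g j) (TwoAss.circ (K := K) (dotWord K g w) y) := by
    rw [mu_succ_apply, h0, h1, h2, dotProd_letters]
  refine key _ rfl (funext fun k => ?_) (Fin.snoc_last (α := fun _ => B) _ _)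
  rw [Fin.succ_castSucc]
  exact Fin.snoc_castSucc (α := fun _ => B) y (fun k => g ((cons j w).letters k)) k.succ

end WordVal

/-! ### The word algebra -/

/-- The vector space of nonempty words in a basis of `M`, a model of the reduced tensor algebra. -/
def WordAlg {K M I : Type*} [Field K] [AddCommGroup M] [Module K M] (_ : Module.Basis I K M) :
    Type _ := NWord I →₀ K

namespace WordAlg

variable {K M I : Type*} [Field K] [AddCommGroup M] [Module K M] (b : Module.Basis I K M)

instance : AddCommGroup (WordAlg b) := inferInstanceAs (AddCommGroup (NWord I →₀ K))

instance : Module K (WordAlg b) := inferInstanceAs (Module K (NWord I →₀ K))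

/-- The basis vector of a word. -/
def word (w : NWord I) : WordAlg b := Finsupp.single w 1

variable {b}

section Lift

variable {V : Type*} [AddCommGroup V] [Module K V]

/-- The linear extension of a function on words. -/
def lift (f : NWord I → V) : WordAlg b →ₗ[K] V := Finsupp.linearCombination K f

theorem lift_word (f : NWord I → V) (w : NWord I) : lift f (word b w) = f w :=
  (Finsupp.linearCombination_single K 1 w).trans (one_smul K _)

theorem hom_ext {f g : WordAlg b →ₗ[K] V} (h : ∀ w, f (word b w) = g (word b w)) : f = g :=
  Finsupp.lhom_ext' fun w => LinearMap.ext_ring (h w)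

end Lift

theorem mem_of_word_mem {P : Submodule K (WordAlg b)} (h : ∀ w, word b w ∈ P) (a : WordAlg b) :
    a ∈ P := by
  have : P.mkQ = 0 := hom_ext fun w => by simpa using h w
  simpa using LinearMap.congr_fun this a

variable (b)

/-- Concatenation. -/
def cat : WordAlg b →ₗ[K] WordAlg b →ₗ[K] WordAlg b :=
  lift fun v => lift fun w => word b (v.append w)

theorem cat_word (v w : NWord I) : cat b (word b v) (word b w) = word b (v.append w) := by
  simp only [cat, lift_word]

theorem cat_assoc (x y z : WordAlg b) : cat b (cat b x y) z = cat b x (cat b y z) := by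
  have h1 (v w : NWord I) : cat b (cat b (word b v) (word b w)) =
      cat b (word b v) ∘ₗ cat b (word b w) :=
    hom_ext fun c => by simp only [LinearMap.comp_apply, cat_word, append_assoc]
  have h2 (v : NWord I) (z : WordAlg b) :
      (cat b).flip z ∘ₗ cat b (word b v) = cat b (word b v) ∘ₗ (cat b).flip z :=
    hom_ext fun w => LinearMap.congr_fun (h1 v w) z
  have h3 : (cat b).flip z ∘ₗ (cat b).flip y = (cat b).flip (cat b y z) :=
    hom_ext fun v => LinearMap.congr_fun (h2 v z) y
  exact LinearMap.congr_fun h3 x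

/-- The inclusion of `M` as the span of the words of length one. -/
def incl : M →ₗ[K] WordAlg b := b.constr K fun i => word b (one i)

theorem incl_basis (i : I) : incl b (b i) = word b (one i) := b.constr_basis K _ i

/-- The projection to `M` along the words of length at least two. -/
def proj : WordAlg b →ₗ[K] M :=
  lift fun w => match w with
    | one i => b i
    | cons _ _ => 0

theorem proj_one (i : I) : proj b (word b (one i)) = b i := lift_word _ _

theorem proj_cons (i : I) (w : NWord I) : proj b (word b (cons i w)) = 0 := lift_word _ _

theorem proj_incl (m : M) : proj b (incl b m) = m := by
  have : proj b ∘ₗ incl b = LinearMap.id := b.ext fun i => by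
    rw [LinearMap.comp_apply, incl_basis, proj_one, LinearMap.id_apply]
  exact LinearMap.congr_fun this m

theorem incl_injective : Function.Injective (incl b) :=
  Function.LeftInverse.injective (proj_incl b)

/-! ### Deconcatenation, its kernel and its cocycles -/

/-- Deconcatenation of words. -/
def decatWord : NWord I → WordAlg b ⊗[K] WordAlg b
  | one _ => 0
  | cons i w => (cat b (word b (one i))).rTensor _ (decatWord w) + word b (one i) ⊗ₜ word b w

/-- Deconcatenation. -/
def decat : WordAlg b →ₗ[K] WordAlg b ⊗[K] WordAlg b := lift (decatWord b)

theorem decat_one (i : I) : decat b (word b (one i)) = 0 := lift_word _ _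

theorem decat_cons (i : I) (w : NWord I) : decat b (word b (cons i w)) =
    (cat b (word b (one i))).rTensor _ (decat b (word b w)) + word b (one i) ⊗ₜ word b w := by
  rw [decat, lift_word, lift_word, decatWord]

theorem decat_incl (m : M) : decat b (incl b m) = 0 := by
  have : decat b ∘ₗ incl b = 0 := b.ext fun i => by
    rw [LinearMap.comp_apply, incl_basis, decat_one, LinearMap.zero_apply]
  exact LinearMap.congr_fun this m

theorem decat_cat_one (i : I) (x : WordAlg b) : decat b (cat b (word b (one i)) x) =
    (cat b (word b (one i))).rTensor _ (decat b x) + word b (one i) ⊗ₜ x := by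
  have : decat b ∘ₗ cat b (word b (one i)) =
      (cat b (word b (one i))).rTensor _ ∘ₗ decat b +
        TensorProduct.mk K _ _ (word b (one i)) := hom_ext fun w => by
    simp only [LinearMap.comp_apply, cat_word, append, decat_cons, LinearMap.add_apply,
      TensorProduct.mk_apply]
  exact LinearMap.congr_fun this x

/-- Induction on the first word: moving its first letter outside by associativity reduces everything
to `decat_cat_one`. -/
theorem isInfinitesimal_cat : IsInfinitesimal (cat b) (decat b) := by
  intro x y
  have h (w : NWord I) : decat b (cat b (word b w) y) = (cat b (word b w)).rTensor _ (decat b y) +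
      ((cat b).flip y).lTensor _ (decat b (word b w)) + word b w ⊗ₜ y := by
    induction w with
    | one i => rw [decat_cat_one, decat_one, map_zero, add_zero]
    | cons i w ih =>
        have h1 : word b (cons i w) = cat b (word b (one i)) (word b w) :=
          (cat_word b (one i) w).symm
        rw [h1, cat_assoc, decat_cat_one, decat_cat_one, ih]
        simp only [map_add, rTensor_rTensor_of (cat_assoc b), LinearMap.lTensor_tmul,
          LinearMap.rTensor_tmul, LinearMap.flip_apply, rTensor_lTensor_comm]
        abel
  have : decat b ∘ₗ (cat b).flip y = (LinearMap.rTensorHom (WordAlg b) ∘ₗ cat b).flip (decat b y) +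
      ((cat b).flip y).lTensor _ ∘ₗ decat b + (TensorProduct.mk K _ _).flip y :=
    hom_ext h
  exact LinearMap.congr_fun this x

/-- `a ⊗ c ↦ p(a) · c`, where `p` is the projection to the words of length one. -/
def headCat : WordAlg b ⊗[K] WordAlg b →ₗ[K] WordAlg b :=
  TensorProduct.lift (cat b ∘ₗ incl b ∘ₗ proj b)

theorem headCat_tmul (x y : WordAlg b) :
    headCat b (x ⊗ₜ y) = cat b (incl b (proj b x)) y := rfl

/-- Among the cuts of a word only the one after the first letter survives `proj` on the left factor,
and gluing it back restores the word. A one-letter word has no cut and is supplied by the second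
term. -/
theorem headCat_decat (x : WordAlg b) : headCat b (decat b x) + incl b (proj b x) = x := by
  have h : headCat b ∘ₗ decat b + incl b ∘ₗ proj b = LinearMap.id := hom_ext fun w => by
    cases w with
    | one i => simp [decat_one, proj_one, incl_basis]
    | cons i w =>
        have h0 : headCat b ∘ₗ (cat b (word b (one i))).rTensor _ = 0 :=
          TensorProduct.ext' fun x y => by
            have : proj b ∘ₗ cat b (word b (one i)) = 0 := hom_ext fun w => by
              simp [cat_word, append, proj_cons]
            have := LinearMap.congr_fun this x
            simp only [LinearMap.comp_apply, LinearMap.zero_apply] at this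
            simp [headCat_tmul, this]
        have h0 := LinearMap.congr_fun h0 (decat b (word b w))
        simp only [LinearMap.comp_apply, LinearMap.zero_apply] at h0
        simp [decat_cons, proj_cons, h0, headCat_tmul, proj_one, incl_basis, cat_word, append]
  exact LinearMap.congr_fun h x

theorem eq_incl_of_decat_eq_zero {x : WordAlg b} (h : decat b x = 0) :
    x = incl b (proj b x) := by
  simpa [h] using (headCat_decat b x).symm

/-- Every cocycle of the reduced cobar complex in degree two is a coboundary. -/
theorem decat_headCat {s : WordAlg b ⊗[K] WordAlg b}
    (hs : TensorProduct.assoc K _ _ _ ((decat b).rTensor _ s) = (decat b).lTensor _ s) :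
    decat b (headCat b s) = s := by
  -- The infinitesimal relation, with the primitive element `incl b (proj b x)` as left factor. The
  -- cocycle condition then turns `decat` on the right factor into `decat` on the left one, where
  -- `headCat_decat` applies.
  have h : decat b ∘ₗ headCat b = (headCat b).rTensor _ ∘ₗ
      (TensorProduct.assoc K _ _ _).symm.toLinearMap ∘ₗ (decat b).lTensor _ +
        (incl b ∘ₗ proj b).rTensor _ := TensorProduct.ext' fun x y => by
    have h1 : ∀ t : WordAlg b ⊗[K] WordAlg b, (cat b (incl b (proj b x))).rTensor _ t =
        (headCat b).rTensor _ ((TensorProduct.assoc K _ _ _).symm (x ⊗ₜ t)) := fun t => by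
      induction t with
      | zero => simp
      | tmul c d => simp [headCat_tmul]
      | add s t hs ht => simp only [map_add, TensorProduct.tmul_add, hs, ht]
    simp [headCat_tmul, isInfinitesimal_cat b _ y, decat_incl, h1]
  have h2 : (headCat b).rTensor (WordAlg b) ∘ₗ (decat b).rTensor _ +
      (incl b ∘ₗ proj b).rTensor _ = LinearMap.id := by
    rw [← LinearMap.rTensor_comp, ← LinearMap.rTensor_add, ← LinearMap.rTensor_id]
    exact congrArg _ (LinearMap.ext (headCat_decat b))
  refine (LinearMap.congr_fun h s).trans ?_
  refine Eq.trans ?_ (LinearMap.congr_fun h2 s)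
  simp only [LinearMap.add_apply, LinearMap.comp_apply, LinearEquiv.coe_coe, ← hs,
    LinearEquiv.symm_apply_apply]

/-! ### The length filtration -/

/-- The span of the words of length at most `n`. -/
def lengthFil (n : ℕ) : Submodule K (WordAlg b) := Submodule.span K (word b '' {w | w.deg < n})

variable {b}

theorem word_mem_lengthFil {w : NWord I} {n : ℕ} (h : w.deg < n) : word b w ∈ lengthFil b n :=
  Submodule.subset_span ⟨w, h, rfl⟩

theorem lengthFil_le {n : ℕ} {P : Submodule K (WordAlg b)}
    (h : ∀ w : NWord I, w.deg < n → word b w ∈ P) : lengthFil b n ≤ P :=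
  Submodule.span_le.2 (by rintro _ ⟨w, hw, rfl⟩; exact h w hw)

theorem lengthFil_mono {m n : ℕ} (h : m ≤ n) : lengthFil b m ≤ lengthFil b n :=
  lengthFil_le fun _ hw => word_mem_lengthFil (hw.trans_le h)

theorem lengthFil_zero : lengthFil b 0 = ⊥ :=
  le_bot_iff.1 (lengthFil_le fun _ hw => absurd hw (Nat.not_lt_zero _))

theorem exists_mem_lengthFil (x : WordAlg b) : ∃ n, x ∈ lengthFil b n := by
  induction x using Finsupp.induction_linear with
  | zero => exact ⟨0, zero_mem _⟩
  | add x y hx hy =>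
      obtain ⟨m, hm⟩ := hx
      obtain ⟨n, hn⟩ := hy
      exact ⟨max m n, add_mem (lengthFil_mono (le_max_left m n) hm)
        (lengthFil_mono (le_max_right m n) hn)⟩
  | single w c =>
      refine ⟨w.deg + 1, ?_⟩
      have : (Finsupp.single w c : NWord I →₀ K) = c • (word b w : NWord I →₀ K) :=
        (Finsupp.smul_single_one w c).symm
      rw [this]
      exact Submodule.smul_mem _ _ (word_mem_lengthFil (Nat.lt_succ_self _))

theorem incl_mem_lengthFil (m : M) : incl b m ∈ lengthFil b 1 := by
  have : LinearMap.range (incl b) ≤ lengthFil b 1 := by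
    rw [LinearMap.range_eq_map, ← b.span_eq, Submodule.map_span, Submodule.span_le]
    rintro _ ⟨_, ⟨i, rfl⟩, rfl⟩
    rw [incl_basis]
    exact word_mem_lengthFil Nat.zero_lt_one
  exact this ⟨m, rfl⟩

theorem cat_mem_lengthFil {m n : ℕ} {x y : WordAlg b} (hx : x ∈ lengthFil b m)
    (hy : y ∈ lengthFil b n) : cat b x y ∈ lengthFil b (m + n) := by
  have h := Submodule.apply_mem_map₂ (cat b) hx hy
  rw [lengthFil, lengthFil, Submodule.map₂_span_span] at h
  refine Submodule.span_le.2 ?_ h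
  rintro _ ⟨_, ⟨v, hv, rfl⟩, _, ⟨w, hw, rfl⟩, rfl⟩
  have hv : v.deg < m := hv
  have hw : w.deg < n := hw
  simp only [cat_word]
  exact word_mem_lengthFil (by rw [deg_append]; omega)

/-- Both pieces of a cut are nonempty, hence strictly shorter than the word. Membership is stated as
a range so that a preimage in the tensor square of the subspace is available for the injectivity
argument. -/
theorem decat_mem_lengthFil {n : ℕ} {x : WordAlg b} (hx : x ∈ lengthFil b (n + 1)) :
    decat b x ∈ LinearMap.range
      (TensorProduct.map (lengthFil b n).subtype (lengthFil b n).subtype) := by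
  refine lengthFil_le (P := Submodule.comap (decat b) (LinearMap.range
    (TensorProduct.map (lengthFil b n).subtype (lengthFil b n).subtype))) (fun w hw => ?_) hx
  rw [Submodule.mem_comap]
  clear hx
  induction w generalizing n with
  | one i => rw [decat_one]; exact zero_mem _
  | cons i w ih =>
      have hw : w.deg + 1 < n + 1 := hw
      obtain ⟨k, rfl⟩ : ∃ k, n = k + 1 := ⟨n - 1, by omega⟩
      rw [decat_cons]
      refine add_mem ?_ ⟨⟨word b (one i), word_mem_lengthFil (Nat.succ_pos k)⟩ ⊗ₜ
        ⟨word b w, word_mem_lengthFil (by omega)⟩, rfl⟩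
      obtain ⟨t, ht⟩ := ih (n := k) (by omega)
      rw [← ht]
      clear ht ih
      induction t with
      | zero => simp
      | tmul c d =>
          refine ⟨⟨cat b (word b (one i)) c, ?_⟩ ⊗ₜ ⟨d, lengthFil_mono (Nat.le_succ k) d.2⟩, rfl⟩
          rw [Nat.add_comm]
          exact cat_mem_lengthFil (word_mem_lengthFil Nat.zero_lt_one) c.2
      | add s t hs ht => simp only [map_add]; exact add_mem hs ht

/-! ### Evaluation of words in a `2-ass` algebra -/

section Eval

variable {B : Type*} [AddCommGroup B] [Module K B] [TwoAss K B] (b)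

/-- The linear map from the word algebra sending a word to the `dot` product of its letters. -/
def eval (f : M →ₗ[K] B) : WordAlg b →ₗ[K] B := lift (dotWord K fun i => f (b i))

theorem eval_word (f : M →ₗ[K] B) (w : NWord I) :
    eval b f (word b w) = dotWord K (fun i => f (b i)) w := lift_word _ _

theorem eval_incl (f : M →ₗ[K] B) (m : M) : eval b f (incl b m) = f m := by
  have : eval b f ∘ₗ incl b = f := b.ext fun i => by
    rw [LinearMap.comp_apply, incl_basis, eval_word, dotWord]
  exact LinearMap.congr_fun this m

theorem eval_cat (f : M →ₗ[K] B) (x y : WordAlg b) :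
    eval b f (cat b x y) = TwoAss.dot (K := K) (eval b f x) (eval b f y) := by
  have : (cat b).compr₂ (eval b f) = TwoAss.dot.compl₁₂ (eval b f) (eval b f) :=
    hom_ext fun v => hom_ext fun w => by
      simp only [LinearMap.compr₂_apply, LinearMap.compl₁₂_apply, cat_word, eval_word,
        dotWord_append]
  exact LinearMap.congr_fun (LinearMap.congr_fun this x) y

end Eval

end WordAlg

open NWord

namespace WordAlg

/-! ### The second product of the word algebra -/

variable {K M I : Type*} [Field K] [AddCommGroup M] [Module K M] [MagInf K M]
  (b : Module.Basis I K M)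

/-- The operation of `M` applied to the letters of a word and a last letter. -/
def opWord (w : NWord I) (i : I) : M :=
  MagInf.op (K := K) w.deg (Fin.snoc (α := fun _ => M) (fun k => b (w.letters k)) (b i))

/-- The product `w ∘ i` of a word and a letter. -/
def circLetterWord (i : I) : NWord I → WordAlg b
  -- Both clauses are forced by the relations of the enveloping algebra: `μ(j, i) = j · i - j ∘ i`,
  -- and `μ(j, w, i) = (j · w) ∘ i - j · (w ∘ i)` for longer tuples. Hence the opposite signs.
  | one j => word b (cons j (one i)) - incl b (opWord b (one j) i)
  | cons j w => cat b (word b (one j)) (circLetterWord i w) + incl b (opWord b (cons j w) i)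

/-- Right `∘`-multiplication by a letter. -/
def circLetter (i : I) : WordAlg b →ₗ[K] WordAlg b := lift (circLetterWord b i)

theorem circLetter_one (i j : I) : circLetter b i (word b (one j)) =
    word b (cons j (one i)) - incl b (opWord b (one j) i) := lift_word _ _

theorem circLetter_cons (i j : I) (w : NWord I) : circLetter b i (word b (cons j w)) =
    cat b (word b (one j)) (circLetter b i (word b w)) + incl b (opWord b (cons j w) i) := by
  simp only [circLetter, lift_word, circLetterWord]

/-- This is the infinitesimal relation with a primitive right factor. The values of the operations
lie in `M`, so `decat` kills them and the induction proceeds as for concatenation. -/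
theorem decat_circLetter (i : I) (x : WordAlg b) :
    decat b (circLetter b i x) = (circLetter b i).lTensor _ (decat b x) +
      x ⊗ₜ word b (one i) := by
  have h (w : NWord I) : decat b (circLetter b i (word b w)) =
      (circLetter b i).lTensor _ (decat b (word b w)) + word b w ⊗ₜ word b (one i) := by
    induction w with
    | one j =>
        rw [circLetter_one, map_sub, decat_incl, decat_cons, decat_one, decat_one]
        simp
    | cons j w ih =>
        rw [circLetter_cons, map_add, decat_incl, decat_cat_one, ih, decat_cons]
        simp only [map_add, LinearMap.lTensor_tmul, LinearMap.rTensor_tmul,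
          rTensor_lTensor_comm, cat_word, append]
        abel
  have : decat b ∘ₗ circLetter b i = (circLetter b i).lTensor _ ∘ₗ decat b +
      (TensorProduct.mk K _ _).flip (word b (one i)) := hom_ext h
  exact LinearMap.congr_fun this x

/-- The leading term of `x ∘ i` is the concatenation `x · i`; the corrections do not exceed the
length of `x`. -/
theorem circLetter_sub_mem (i : I) {n : ℕ} {x : WordAlg b} (hx : x ∈ lengthFil b n) :
    circLetter b i x - cat b x (word b (one i)) ∈ lengthFil b n := by
  suffices h : lengthFil b n ≤ (lengthFil b n).comap
      (circLetter b i - (cat b).flip (word b (one i))) from h hx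
  refine lengthFil_le fun w hw => ?_
  simp only [Submodule.mem_comap, LinearMap.sub_apply, LinearMap.flip_apply]
  clear hx
  induction w generalizing n with
  | one j =>
      rw [circLetter_one, cat_word, append, sub_sub_cancel_left]
      exact neg_mem (lengthFil_mono (by omega) (incl_mem_lengthFil _))
  | cons j w ih =>
      have hw : w.deg + 1 < n := hw
      have h1 : word b (cons j w) = cat b (word b (one j)) (word b w) :=
        (cat_word b (one j) w).symm
      rw [circLetter_cons, h1, cat_assoc, add_sub_right_comm, ← map_sub]
      -- The induction hypothesis is taken at the sharp bound `w.deg + 1`, leaving room for the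
      -- letter put back in front.
      refine add_mem (lengthFil_mono ?_ (cat_mem_lengthFil (m := 1) (n := w.deg + 1)
        (word_mem_lengthFil Nat.zero_lt_one) (ih (Nat.lt_succ_self _))))
        (lengthFil_mono (by omega) (incl_mem_lengthFil _))
      omega

theorem circLetter_mem (i : I) {n : ℕ} {x : WordAlg b} (hx : x ∈ lengthFil b n) :
    circLetter b i x ∈ lengthFil b (n + 1) := by
  rw [← sub_add_cancel (circLetter b i x) (cat b x (word b (one i)))]
  exact add_mem (lengthFil_mono (Nat.le_succ n) (circLetter_sub_mem b i hx))
    (cat_mem_lengthFil hx (word_mem_lengthFil Nat.zero_lt_one))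

/-- Successive right `∘`-multiplication by the letters of a word. -/
def circLetters : NWord I → WordAlg b →ₗ[K] WordAlg b
  | one i => circLetter b i
  | cons i w => circLetters w ∘ₗ circLetter b i

theorem circLetters_append (v w : NWord I) :
    circLetters b (v.append w) = circLetters b w ∘ₗ circLetters b v := by
  induction v with
  | one i => rfl
  | cons i v ih => simp only [append, circLetters, ih, LinearMap.comp_assoc]

/-- The bound is one less than the length of the concatenation. The difference telescopes through
`(x ∘ i) · w`, where `i` is the first letter of the multiplying word and `w` the rest. -/
theorem circLetters_sub_mem (w : NWord I) {n : ℕ} {x : WordAlg b} (hx : x ∈ lengthFil b n) :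
    circLetters b w x - cat b x (word b w) ∈ lengthFil b (n + w.deg) := by
  induction w generalizing n x with
  | one i => exact circLetter_sub_mem b i hx
  | cons i w ih =>
      have h1 : word b (cons i w) = cat b (word b (one i)) (word b w) :=
        (cat_word b (one i) w).symm
      have h2 := cat_mem_lengthFil (circLetter_sub_mem b i hx)
        (word_mem_lengthFil (b := b) (Nat.lt_succ_self w.deg))
      have h3 := add_mem (lengthFil_mono (n := n + (w.deg + 1)) (by omega)
        (ih (circLetter_mem b i hx))) h2
      rw [map_sub, LinearMap.sub_apply, sub_add_sub_cancel, cat_assoc, ← h1] at h3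
      exact h3

/-- The `∘`-product of the letters of a word. -/
def circWord : NWord I → WordAlg b
  | one i => word b (one i)
  | cons i w => circLetters b w (word b (one i))

theorem circWord_append (v w : NWord I) :
    circWord b (v.append w) = circLetters b w (circWord b v) := by
  cases v with
  | one i => rfl
  | cons i v => simp only [append, circWord, circLetters_append, LinearMap.comp_apply]

/-- The map sending a word to the `∘`-product of its letters. -/
def circMap : WordAlg b →ₗ[K] WordAlg b := lift (circWord b)

theorem circMap_word (w : NWord I) : circMap b (word b w) = circWord b w := lift_word _ _

/-- `circMap` is unitriangular for the length filtration. -/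
theorem circMap_sub_mem {n : ℕ} {x : WordAlg b} (hx : x ∈ lengthFil b (n + 1)) :
    circMap b x - x ∈ lengthFil b n := by
  suffices h : lengthFil b (n + 1) ≤ (lengthFil b n).comap (circMap b - LinearMap.id) from h hx
  refine lengthFil_le fun w hw => ?_
  rw [Submodule.mem_comap, LinearMap.sub_apply, LinearMap.id_apply, circMap_word]
  cases w with
  | one i => rw [circWord, sub_self]; exact zero_mem _
  | cons i w =>
      have hw : w.deg + 1 < n + 1 := hw
      have h1 : word b (cons i w) = cat b (word b (one i)) (word b w) :=
        (cat_word b (one i) w).symm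
      rw [h1]
      exact lengthFil_mono (by omega) (circLetters_sub_mem b w (n := 1)
        (word_mem_lengthFil Nat.zero_lt_one))

/-- A unitriangular map for an exhaustive filtration that starts at zero: an element of the kernel
descends to length zero, and an element is hit up to a shorter one. -/
theorem circMap_bijective : Function.Bijective (circMap b) := by
  constructor
  · refine (injective_iff_map_eq_zero _).2 fun x hx => ?_
    obtain ⟨n, hn⟩ := exists_mem_lengthFil x
    induction n with
    | zero => rwa [lengthFil_zero, Submodule.mem_bot] at hn
    | succ n ih =>
        refine ih ?_
        have := circMap_sub_mem b hn
        rwa [hx, zero_sub, neg_mem_iff] at this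
  · intro x
    obtain ⟨n, hn⟩ := exists_mem_lengthFil x
    rw [← Set.mem_range]
    change x ∈ LinearMap.range (circMap b)
    induction n generalizing x with
    | zero =>
        rw [lengthFil_zero, Submodule.mem_bot] at hn
        rw [hn]
        exact zero_mem _
    | succ n ih =>
        rw [← sub_sub_cancel (circMap b x) x]
        exact sub_mem ⟨x, rfl⟩ (ih _ (circMap_sub_mem b hn))

/-! ### Transport of concatenation along `circMap` -/

def circEquiv : WordAlg b ≃ₗ[K] WordAlg b := LinearEquiv.ofBijective _ (circMap_bijective b)

/-- The product transported from concatenation along `circMap`. -/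
def circMul : WordAlg b →ₗ[K] WordAlg b →ₗ[K] WordAlg b :=
  ((cat b).compl₁₂ (circEquiv b).symm.toLinearMap (circEquiv b).symm.toLinearMap).compr₂
    (circMap b)

theorem circMul_circMap (x y : WordAlg b) :
    circMul b (circMap b x) (circMap b y) = circMap b (cat b x y) := by
  have h (x : WordAlg b) : (circEquiv b).symm (circMap b x) = x :=
    (circEquiv b).symm_apply_apply x
  simp only [circMul, LinearMap.compr₂_apply, LinearMap.compl₁₂_apply, LinearEquiv.coe_coe, h]

theorem circMul_assoc (x y z : WordAlg b) :
    circMul b (circMul b x y) z = circMul b x (circMul b y z) := by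
  obtain ⟨x, rfl⟩ := (circMap_bijective b).2 x
  obtain ⟨y, rfl⟩ := (circMap_bijective b).2 y
  obtain ⟨z, rfl⟩ := (circMap_bijective b).2 z
  simp only [circMul_circMap, cat_assoc]

/-- On an element `circWord b w`, multiplying by the letter `i` gives the `circWord` of `w` followed
by `i`, which by construction is one more application of `circLetter`. Such elements span, so the
transported product extends the prescribed recursion. -/
theorem circMul_letter (x : WordAlg b) (i : I) :
    circMul b x (word b (one i)) = circLetter b i x := by
  obtain ⟨x, rfl⟩ := (circMap_bijective b).2 x
  have h : (circMul b).flip (word b (one i)) ∘ₗ circMap b = circLetter b i ∘ₗ circMap b :=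
    hom_ext fun w => by
      have h1 : word b (one i) = circMap b (word b (one i)) := (circMap_word b (one i)).symm
      rw [LinearMap.comp_apply, LinearMap.flip_apply]
      conv_lhs => rw [h1]
      rw [circMul_circMap, cat_word, LinearMap.comp_apply, circMap_word, circMap_word,
        circWord_append]
      rfl
  exact LinearMap.congr_fun h x

theorem circWord_cons (i : I) (w : NWord I) :
    circWord b (cons i w) = circMul b (word b (one i)) (circWord b w) := by
  have h1 : word b (one i) = circMap b (word b (one i)) := (circMap_word b (one i)).symm
  rw [h1, ← circMap_word b (cons i w), ← circMap_word b w, circMul_circMap, cat_word]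
  rfl

instance : TwoAss K (WordAlg b) where
  dot := cat b
  circ := circMul b
  dot_assoc := cat_assoc b
  circ_assoc := circMul_assoc b

theorem dot_eq : TwoAss.dot (K := K) (A := WordAlg b) = cat b := rfl

theorem circ_eq : TwoAss.circ (K := K) (A := WordAlg b) = circMul b := rfl

theorem generates_letters : Generates K (fun i => word b (one i)) := by
  intro P h1 h2 _ a
  refine mem_of_word_mem (fun w => ?_) a
  induction w with
  | one i => exact h1 i
  | cons i w ih => exact cat_word b (one i) w ▸ h2 _ (h1 i) _ ih

/-- An induction principle: the word algebra is generated by its letters under `∘`. -/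
theorem mem_of_circ_mem {P : Submodule K (WordAlg b)} (h1 : ∀ i, word b (one i) ∈ P)
    (h2 : ∀ x ∈ P, ∀ y ∈ P, circMul b x y ∈ P) (a : WordAlg b) : a ∈ P := by
  obtain ⟨a, rfl⟩ := (circMap_bijective b).2 a
  refine mem_of_word_mem (P := P.comap (circMap b)) (fun w => ?_) a
  rw [Submodule.mem_comap, circMap_word]
  induction w with
  | one i => exact h1 i
  | cons i w ih => exact circWord_cons b i w ▸ h2 _ (h1 i) _ ih

/-- A linear map which is compatible with `∘`-multiplication by letters on the right is
compatible with `∘`. -/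
theorem map_circ_of_letter {B : Type*} [AddCommGroup B] [Module K B] (m : B →ₗ[K] B →ₗ[K] B)
    (hm : ∀ x y z, m (m x y) z = m x (m y z)) (f : WordAlg b →ₗ[K] B)
    (h : ∀ x i, f (circLetter b i x) = m (f x) (f (word b (one i)))) (x y : WordAlg b) :
    f (circMul b x y) = m (f x) (f y) := by
  -- The right factors `y` that work for every `x` at once. Associativity on both sides makes them
  -- closed under `∘`, so it suffices that they include the letters.
  let P : Submodule K (WordAlg b) := LinearMap.eqLocus ((circMul b).compr₂ f).flip
    (m.compl₁₂ f f).flip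
  have hP (y : WordAlg b) : y ∈ P ↔ ∀ x, f (circMul b x y) = m (f x) (f y) :=
    LinearMap.ext_iff
  refine (hP y).1 (mem_of_circ_mem b (fun i => ?_) (fun y hy z hz => ?_) y) x
  · exact (hP _).2 fun x => by rw [circMul_letter, h]
  · rw [hP] at hy hz ⊢
    intro x
    rw [← circMul_assoc, hz, hy, hz, hm]

/-- The relation says that `x ↦ (x, decat b x)` is multiplicative into the auxiliary algebra with
product `extMul`. It is therefore enough to multiply by letters, where it is `decat_circLetter`. -/
theorem isInfinitesimal_circMul : IsInfinitesimal (circMul b) (decat b) := by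
  intro x y
  have h := map_circ_of_letter b (extMul (circMul b)) (extMul_assoc (circMul_assoc b))
    (LinearMap.prod LinearMap.id (decat b)) (fun x i => ?_) x y
  · exact congrArg Prod.snd h
  · have h1 : (circMul b).flip (word b (one i)) = circLetter b i :=
      LinearMap.ext fun x => circMul_letter b x i
    ext1
    · exact (circMul_letter b x i).symm
    · change decat b (circLetter b i x) =
        (circMul b x).rTensor _ (decat b (word b (one i))) +
          ((circMul b).flip (word b (one i))).lTensor _ (decat b x) + x ⊗ₜ word b (one i)
      rw [h1, decat_one, map_zero, zero_add]
      exact decat_circLetter b i x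

instance : TwoInfBialgebra K (WordAlg b) :=
  bialgebraOfHom (fun i => word b (one i)) (generates_letters b)
    (LinearMap.prod LinearMap.id (decat b))
    ⟨fun x y => Prod.ext rfl (isInfinitesimal_cat b x y),
      fun x y => Prod.ext rfl (isInfinitesimal_circMul b x y)⟩
    (fun i => Prod.ext rfl (decat_one b i))

theorem comul_eq : TwoInfBialgebra.comul (K := K) (A := WordAlg b) = decat b := rfl

theorem dotWord_letter (w : NWord I) : dotWord K (fun i => word b (one i)) w = word b w := by
  induction w with
  | one i => rfl
  | cons i w ih => rw [dotWord, ih]; exact cat_word b (one i) w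

/-- By multilinearity only basis tuples matter, and there the recursion defining `circLetter` was
chosen so that `μ` leaves exactly the correction term. -/
theorem incl_op (n : ℕ) (x : Fin (n + 2) → M) :
    incl b (MagInf.op (K := K) n x) = mu K (WordAlg b) n (fun i => incl b (x i)) := by
  have : (incl b).compMultilinearMap (MagInf.op (K := K) n) =
      (mu K (WordAlg b) n).compLinearMap (fun _ => incl b) := by
    refine Module.Basis.ext_multilinear (fun _ => b) fun v => ?_
    rw [LinearMap.compMultilinearMap_apply, MultilinearMap.compLinearMap_apply]
    obtain ⟨w, hw⟩ := exists_letters_eq n (fun i => v i.castSucc)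
    have hv : v = Fin.snoc (α := fun _ => I) (fun i => v i.castSucc) (v (Fin.last _)) :=
      (Fin.snoc_init_self v).symm
    generalize (fun i : Fin (n + 1) => v i.castSucc) = l at hw hv
    generalize v (Fin.last _) = i at hv
    -- Identifies the arity with `w.deg` and the initial letters with `w.letters`.
    cases hw
    have h1 : (fun k => b (v k)) =
        Fin.snoc (α := fun _ => M) (fun k => b (w.letters k)) (b i) := by
      rw [hv]
      exact Fin.comp_snoc b w.letters i
    have h2 : (fun k => word b (one (v k))) =
        Fin.snoc (α := fun _ => WordAlg b) (fun k => word b (one (w.letters k)))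
          (word b (one i)) := by
      rw [hv]
      exact Fin.comp_snoc (fun j => word b (one j)) w.letters i
    simp only [incl_basis]
    rw [h1, h2]
    change incl b (opWord b w i) = _
    cases w with
    | one j =>
        rw [mu_letters_one (fun j => word b (one j)), dot_eq, circ_eq, circMul_letter, circLetter_one, cat_word, append,
          sub_sub_cancel]
    | cons j w =>
        rw [mu_letters_cons (fun j => word b (one j)), dot_eq, circ_eq, dotWord_letter, cat_word, append, circMul_letter,
          circMul_letter, circLetter_cons, add_sub_cancel_left]
  exact MultilinearMap.congr_fun this x

/-! ### Evaluation respects both products -/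

section Eval

variable {B : Type*} [AddCommGroup B] [Module K B] [TwoAss K B]

/-- Since `f` carries the operations of `M` to those of `B`, the right `∘`-multiplication of `B`
obeys the recursion that defines `circLetter`. -/
theorem eval_circLetter (f : M →ₗ[K] B)
    (hf : ∀ (n : ℕ) (x : Fin (n + 2) → M),
      f (MagInf.op (K := K) n x) = mu K B n (fun i => f (x i))) (i : I) (x : WordAlg b) :
    eval b f (circLetter b i x) = TwoAss.circ (K := K) (eval b f x) (f (b i)) := by
  have hop (w : NWord I) : f (opWord b w i) = mu K B w.deg
      (Fin.snoc (α := fun _ => B) (fun k => f (b (w.letters k))) (f (b i))) := by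
    rw [opWord, hf]
    exact congrArg _ (Fin.comp_snoc f (fun k => b (w.letters k)) (b i))
  have : eval b f ∘ₗ circLetter b i = TwoAss.circ.flip (f (b i)) ∘ₗ eval b f :=
    hom_ext fun w => by
      simp only [LinearMap.comp_apply, LinearMap.flip_apply]
      induction w with
      | one j =>
          rw [circLetter_one, map_sub, eval_incl, hop,
            mu_letters_one (fun i => f (b i)), eval_word, eval_word]
          exact sub_sub_cancel _ _
      | cons j w ih =>
          rw [circLetter_cons, map_add, eval_incl, hop,
            mu_letters_cons (fun i => f (b i)), eval_cat, ih, eval_word, eval_word, eval_word]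
          exact add_sub_cancel _ _
  exact LinearMap.congr_fun this x

theorem eval_isTwoAssHom (f : M →ₗ[K] B)
    (hf : ∀ (n : ℕ) (x : Fin (n + 2) → M),
      f (MagInf.op (K := K) n x) = mu K B n (fun i => f (x i))) : IsTwoAssHom (eval b f) :=
  ⟨eval_cat b f, map_circ_of_letter b _ TwoAss.circ_assoc _ fun x i => by
    rw [eval_circLetter b f hf, eval_word, dotWord]⟩

end Eval

end WordAlg

/-! ### Morphisms of bialgebras and primitive parts -/

section BialgebraHom

variable {K A B : Type*} [Field K] [AddCommGroup A] [Module K A] [AddCommGroup B] [Module K B]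

/-- The elements on which `f` commutes with the coproducts are closed under the product, so
compatibility can be tested on generators. -/
theorem map_infinitesimal {m : A →ₗ[K] A →ₗ[K] A} {m' : B →ₗ[K] B →ₗ[K] B}
    {Δ : A →ₗ[K] A ⊗[K] A} {Δ' : B →ₗ[K] B ⊗[K] B} (h : IsInfinitesimal m Δ)
    (h' : IsInfinitesimal m' Δ') {f : A →ₗ[K] B} (hf : ∀ x y, f (m x y) = m' (f x) (f y))
    {x y : A} (hx : Δ' (f x) = TensorProduct.map f f (Δ x))
    (hy : Δ' (f y) = TensorProduct.map f f (Δ y)) :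
    Δ' (f (m x y)) = TensorProduct.map f f (Δ (m x y)) := by
  have h1 (t : A ⊗[K] A) : TensorProduct.map f f ((m x).rTensor A t) =
      (m' (f x)).rTensor B (TensorProduct.map f f t) := by
    induction t with
    | zero => simp
    | tmul c d => simp [hf]
    | add s t hs ht => simp only [map_add, hs, ht]
  have h2 (t : A ⊗[K] A) : TensorProduct.map f f ((m.flip y).lTensor A t) =
      (m'.flip (f y)).lTensor B (TensorProduct.map f f t) := by
    induction t with
    | zero => simp
    | tmul c d => simp [hf]
    | add s t hs ht => simp only [map_add, hs, ht]
  rw [hf, h', h, hx, hy, map_add, map_add, h1, h2, TensorProduct.map_tmul]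

variable [TwoInfBialgebra K A] [TwoInfBialgebra K B]

/-- A morphism of `2-ass` algebras which sends primitive generators to primitive elements is a
morphism of bialgebras. -/
theorem IsTwoAssHom.isTwoInfBialgebraHom {X : Type*} {g : X → A} (hg : Generates K g)
    (h0 : ∀ x, g x ∈ Prim K A) {f : A →ₗ[K] B} (hf : IsTwoAssHom f)
    (h : ∀ x, f (g x) ∈ Prim K B) : IsTwoInfBialgebraHom f :=
  { hf with
    map_comul := fun a => hg (LinearMap.eqLocus (TwoInfBialgebra.comul ∘ₗ f)
        (TensorProduct.map f f ∘ₗ TwoInfBialgebra.comul))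
      (fun x => by
        have h1 : TwoInfBialgebra.comul (K := K) (g x) = 0 := h0 x
        have h2 : TwoInfBialgebra.comul (K := K) (f (g x)) = 0 := h x
        simp [LinearMap.mem_eqLocus, h1, h2])
      (fun _ hx _ hy => map_infinitesimal TwoInfBialgebra.comul_dot TwoInfBialgebra.comul_dot
        hf.map_dot hx hy)
      (fun _ hx _ hy => map_infinitesimal TwoInfBialgebra.comul_circ TwoInfBialgebra.comul_circ
        hf.map_circ hx hy) a }

theorem IsTwoInfBialgebraHom.map_mem_Prim {f : A →ₗ[K] B} (hf : IsTwoInfBialgebraHom f) {x : A}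
    (hx : x ∈ Prim K A) : f x ∈ Prim K B := by
  have h : TwoInfBialgebra.comul (K := K) x = 0 := hx
  exact (hf.map_comul x).trans (by rw [h, map_zero])

theorem IsTwoInfBialgebraHom.comp {C : Type*} [AddCommGroup C] [Module K C]
    [TwoInfBialgebra K C] {g : B →ₗ[K] C} {f : A →ₗ[K] B} (hg : IsTwoInfBialgebraHom g)
    (hf : IsTwoInfBialgebraHom f) : IsTwoInfBialgebraHom (g ∘ₗ f) :=
  { hg.toIsTwoAssHom.comp hf.toIsTwoAssHom with
    map_comul := fun x => by
      rw [LinearMap.comp_apply, hg.map_comul, hf.map_comul, TensorProduct.map_comp,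
        LinearMap.comp_apply] }

/-- With `lTensor_map`, this pulls coassociativity in `B` back along an injective morphism to a
cocycle condition in `A`. -/
theorem IsTwoInfBialgebraHom.assoc_rTensor_map {f : A →ₗ[K] B} (hf : IsTwoInfBialgebraHom f)
    (t : A ⊗[K] A) :
    TensorProduct.assoc K B B B (TwoInfBialgebra.comul.rTensor B (TensorProduct.map f f t)) =
      TensorProduct.map f (TensorProduct.map f f)
        (TensorProduct.assoc K A A A (TwoInfBialgebra.comul.rTensor A t)) := by
  induction t with
  | zero => simp
  | tmul c d =>
      simp only [TensorProduct.map_tmul, LinearMap.rTensor_tmul, hf.map_comul]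
      generalize TwoInfBialgebra.comul (K := K) c = u
      induction u with
      | zero => simp
      | tmul _ _ => rfl
      | add s t hs ht => simp only [map_add, TensorProduct.add_tmul, hs, ht]
  | add s t hs ht => simp only [map_add, hs, ht]

theorem IsTwoInfBialgebraHom.lTensor_map {f : A →ₗ[K] B} (hf : IsTwoInfBialgebraHom f)
    (t : A ⊗[K] A) :
    TwoInfBialgebra.comul.lTensor B (TensorProduct.map f f t) =
      TensorProduct.map f (TensorProduct.map f f) (TwoInfBialgebra.comul.lTensor A t) := by
  induction t with
  | zero => simp
  | tmul c d => simp only [TensorProduct.map_tmul, LinearMap.lTensor_tmul, hf.map_comul]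
  | add s t hs ht => simp only [map_add, hs, ht]

/-- The map induced by a morphism of bialgebras on the primitive parts. -/
def primMap {f : A →ₗ[K] B} (hf : IsTwoInfBialgebraHom f) : Prim K A →ₗ[K] Prim K B :=
  f.restrict fun _ hx => hf.map_mem_Prim hx

theorem coe_primMap {f : A →ₗ[K] B} (hf : IsTwoInfBialgebraHom f) (x : Prim K A) :
    (primMap hf x : B) = f x := rfl

theorem primMap_isMagInfHom {f : A →ₗ[K] B} (hf : IsTwoInfBialgebraHom f) :
    IsMagInfHom (primMap hf) := fun n x => Subtype.ext (by
  rw [coe_primMap, coe_prim_op, coe_prim_op, hf.toIsTwoAssHom.map_mu]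
  rfl)

end BialgebraHom

/-! ### The enveloping algebra as a word algebra -/

section EnvEquiv

variable {K M I : Type*} [Field K] [AddCommGroup M] [Module K M] [MagInf K M]
  (b : Module.Basis I K M)

/-- The enveloping algebra is isomorphic to the word algebra. -/
def envEquiv : UEnv K M ≃ₗ[K] WordAlg b :=
  LinearEquiv.ofLinearMap (envLift (WordAlg.incl b) (WordAlg.incl_op b))
    (WordAlg.eval b (envι K M))
    -- Each composite is an endomorphism of `2-ass` algebras fixing generators, hence the identity.
    (LinearMap.ext ((WordAlg.generates_letters b).id_of_hom
      ((envLift_isTwoAssHom _ (WordAlg.incl_op b)).comp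
        (WordAlg.eval_isTwoAssHom b _ (envι_op K M)))
      fun i => by
        rw [← WordAlg.incl_basis, LinearMap.comp_apply, WordAlg.eval_incl, envLift_ι]))
    (LinearMap.ext (generates_envι.id_of_hom
      ((WordAlg.eval_isTwoAssHom b _ (envι_op K M)).comp
        (envLift_isTwoAssHom _ (WordAlg.incl_op b)))
      fun m => by rw [LinearMap.comp_apply, envLift_ι, WordAlg.eval_incl]))

theorem envEquiv_ι (m : M) : envEquiv b (envι K M m) = WordAlg.incl b m := envLift_ι _ (WordAlg.incl_op b) m

theorem envEquiv_symm_incl (m : M) : (envEquiv b).symm (WordAlg.incl b m) = envι K M m :=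
  (LinearEquiv.symm_apply_eq _).2 (envEquiv_ι b m).symm

theorem envEquiv_isTwoInfBialgebraHom : IsTwoInfBialgebraHom (envEquiv b).toLinearMap :=
  (envLift_isTwoAssHom _ (WordAlg.incl_op b)).isTwoInfBialgebraHom generates_envι comul_envι
    fun m => (congrArg TwoInfBialgebra.comul (envEquiv_ι b m)).trans (WordAlg.decat_incl b m)

theorem envEquiv_symm_isTwoInfBialgebraHom :
    IsTwoInfBialgebraHom (envEquiv b).symm.toLinearMap :=
  (WordAlg.eval_isTwoAssHom b _ (envι_op K M)).isTwoInfBialgebraHom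
    (WordAlg.generates_letters b) (WordAlg.decat_one b) fun i => by
      rw [← WordAlg.incl_basis, WordAlg.eval_incl]
      exact comul_envι (b i)

theorem envι_injective : Function.Injective (envι K M) := fun m n h => by
  have b := Module.Basis.ofVectorSpace K M
  apply WordAlg.incl_injective b
  rw [← envEquiv_ι, h, envEquiv_ι]

/-- In the word model, primitive means killed by deconcatenation, which leaves only words of length
one. -/
theorem exists_envι_eq_of_mem_Prim {x : UEnv K M} (hx : x ∈ Prim K (UEnv K M)) :
    ∃ m, envι K M m = x := by
  have b := Module.Basis.ofVectorSpace K M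
  refine ⟨WordAlg.proj b (envEquiv b x), (envEquiv b).injective ?_⟩
  rw [envEquiv_ι]
  exact (WordAlg.eq_incl_of_decat_eq_zero b
    ((envEquiv_isTwoInfBialgebraHom b).map_mem_Prim hx)).symm

variable (K M) in
/-- A `Mag(∞)` algebra is the primitive part of its enveloping algebra. -/
def primEnvEquiv : M ≃ₗ[K] Prim K (UEnv K M) :=
  LinearEquiv.ofBijective ((envι K M).codRestrict _ comul_envι)
    ⟨fun _ _ h => envι_injective (congrArg Subtype.val h), fun x => by
      obtain ⟨m, hm⟩ := exists_envι_eq_of_mem_Prim x.2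
      exact ⟨m, Subtype.ext hm⟩⟩

theorem coe_primEnvEquiv (m : M) : (primEnvEquiv K M m : UEnv K M) = envι K M m := rfl

theorem primEnvEquiv_isMagInfHom : IsMagInfHom (primEnvEquiv K M).toLinearMap :=
  fun n x => Subtype.ext ((envι_op K M n x).trans
    (coe_prim_op n fun i => primEnvEquiv K M (x i)).symm)

theorem primEnvEquiv_symm_isMagInfHom : IsMagInfHom (primEnvEquiv K M).symm.toLinearMap :=
  fun n x => (primEnvEquiv K M).injective (by
    have h := primEnvEquiv_isMagInfHom (K := K) (M := M) n fun i => (primEnvEquiv K M).symm (x i)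
    simp only [LinearEquiv.coe_coe, LinearEquiv.apply_symm_apply] at h ⊢
    exact h.symm)

end EnvEquiv

/-! ### Connected bialgebras -/

section Connected

variable {K A M I : Type*} [Field K] [AddCommGroup A] [Module K A] [TwoInfBialgebra K A]
  [AddCommGroup M] [Module K M] [MagInf K M] {b : Module.Basis I K M}

theorem map_injective_of_injective {U V : Type*} [AddCommGroup U] [Module K U]
    [AddCommGroup V] [Module K V] {U' V' : Type*} [AddCommGroup U'] [Module K U']
    [AddCommGroup V'] [Module K V'] {f : U →ₗ[K] V} {g : U' →ₗ[K] V'}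
    (hf : Function.Injective f) (hg : Function.Injective g) :
    Function.Injective (TensorProduct.map f g) := by
  rw [← LinearMap.lTensor_comp_rTensor]
  exact (Module.Flat.lTensor_preserves_injective_linearMap g hg).comp
    (Module.Flat.rTensor_preserves_injective_linearMap f hf)

/-- A morphism of bialgebras from a word algebra is injective if it is so on `M`. -/
theorem WordAlg.injective_of_incl {f : WordAlg b →ₗ[K] A} (hf : IsTwoInfBialgebraHom f)
    (h : ∀ m, f (incl b m) = 0 → m = 0) : Function.Injective f := by
  suffices key : ∀ n, ∀ x ∈ lengthFil b n, f x = 0 → x = 0 from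
    (injective_iff_map_eq_zero f).2 fun x hx => by
      obtain ⟨n, hn⟩ := exists_mem_lengthFil x
      exact key n x hn hx
  intro n
  induction n with
  | zero =>
      intro x hx _
      rwa [lengthFil_zero, Submodule.mem_bot] at hx
  | succ n ih =>
      intro x hx h0
      -- The coproduct of `x` lives in the tensor square of a piece on which `f` is already
      -- injective. Over a field the tensor square of that restriction is injective too, so `x` is
      -- primitive and the hypothesis on `M` applies.
      obtain ⟨t, ht⟩ := decat_mem_lengthFil hx
      have hinj : Function.Injective (f ∘ₗ (lengthFil b n).subtype) :=
        (injective_iff_map_eq_zero _).2 fun y hy => Subtype.ext (ih y y.2 hy)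
      have h1 : TensorProduct.map f f (decat b x) = 0 := by
        rw [← comul_eq, ← hf.map_comul, h0, map_zero]
      rw [← ht, ← LinearMap.comp_apply, ← TensorProduct.map_comp] at h1
      have h2 : t = 0 := map_injective_of_injective hinj hinj (h1.trans (map_zero _).symm)
      rw [h2, map_zero] at ht
      have h3 := eq_incl_of_decat_eq_zero b ht.symm
      rw [h3] at h0 ⊢
      rw [h _ h0, map_zero]

/-- An injective morphism of bialgebras from a word algebra to a connected bialgebra is surjective
if its range contains the primitive elements. -/
theorem WordAlg.surjective_of_connected (hA : IsConnected K A) {f : WordAlg b →ₗ[K] A}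
    (hf : IsTwoInfBialgebraHom f) (hinj : Function.Injective f)
    (h : Prim K A ≤ LinearMap.range f) : Function.Surjective f := by
  suffices key : ∀ p, primFiltration K A p ≤ LinearMap.range f from fun x => by
    obtain ⟨p, hp⟩ := hA x
    exact key p hp
  intro p
  induction p with
  | zero => exact h
  | succ p ih =>
      intro x hx
      have hx : TwoInfBialgebra.comul (K := K) x ∈
        Submodule.map₂ (TensorProduct.mk K A A) (primFiltration K A p) (primFiltration K A p) := hx
      have hle : Submodule.map₂ (TensorProduct.mk K A A) (primFiltration K A p)
          (primFiltration K A p) ≤ LinearMap.range (TensorProduct.map f f) :=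
        Submodule.map₂_le.2 fun y hy z hz => by
          obtain ⟨y, rfl⟩ := ih hy
          obtain ⟨z, rfl⟩ := ih hz
          exact ⟨y ⊗ₜ z, rfl⟩
      -- By induction the coproduct of `x` comes from a tensor `s` of words. Injectivity of the
      -- triple tensor power of `f` makes `s` a cocycle, so `s` is the coproduct of `headCat b s`,
      -- whose image differs from `x` by a primitive.
      obtain ⟨s, hs⟩ := hle hx
      have h3 := TwoInfBialgebra.coassoc (K := K) x
      rw [← hs, hf.assoc_rTensor_map, hf.lTensor_map] at h3
      have h4 := decat_headCat b
        (map_injective_of_injective hinj (map_injective_of_injective hinj hinj) h3)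
      have h5 : x - f (headCat b s) ∈ Prim K A := by
        have : TwoInfBialgebra.comul (K := K) (f (headCat b s)) =
            TwoInfBialgebra.comul (K := K) x := by
          rw [hf.map_comul, comul_eq, h4, hs]
        rw [Prim, LinearMap.mem_ker, map_sub, this, sub_self]
      rw [← sub_add_cancel x (f (headCat b s))]
      exact add_mem (h h5) ⟨_, rfl⟩

/-- The structure theorem for connected bialgebras. -/
theorem exists_env_prim_equiv (hA : IsConnected K A) :
    ∃ Φ : UEnv K (Prim K A) ≃ₗ[K] A, IsTwoInfBialgebraHom Φ.toLinearMap ∧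
      ∀ p : Prim K A, Φ (envι K (Prim K A) p) = (p : A) := by
  have hop (n : ℕ) (x : Fin (n + 2) → Prim K A) :
      (Prim K A).subtype (MagInf.op (K := K) n x) =
        mu K A n (fun i => (Prim K A).subtype (x i)) := coe_prim_op n x
  obtain ⟨φ, hφ', hφι⟩ : ∃ φ : UEnv K (Prim K A) →ₗ[K] A, IsTwoAssHom φ ∧
      ∀ p : Prim K A, φ (envι K (Prim K A) p) = (Prim K A).subtype p :=
    ⟨envLift (Prim K A).subtype hop, envLift_isTwoAssHom _ hop, envLift_ι _ hop⟩
  have hφ : IsTwoInfBialgebraHom φ :=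
    hφ'.isTwoInfBialgebraHom (generates_envι (K := K) (M := Prim K A))
      (comul_envι (K := K) (M := Prim K A))
      fun p => by rw [hφι]; exact p.2
  have b := Module.Basis.ofVectorSpace K (Prim K A)
  have hf := hφ.comp (envEquiv_symm_isTwoInfBialgebraHom b)
  have hincl (p : Prim K A) : (φ ∘ₗ (envEquiv b).symm.toLinearMap) (WordAlg.incl b p) = p := by
    rw [LinearMap.comp_apply, LinearEquiv.coe_coe, envEquiv_symm_incl, hφι,
      Submodule.subtype_apply]
  have hinj := WordAlg.injective_of_incl hf fun p hp => Subtype.ext ((hincl p).symm.trans hp)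
  have hsurj := WordAlg.surjective_of_connected hA hf hinj fun p hp => ⟨_, hincl ⟨p, hp⟩⟩
  have hbij : Function.Bijective φ := by
    rw [LinearMap.coe_comp, LinearEquiv.coe_toLinearMap] at hinj hsurj
    exact ⟨(Function.Injective.of_comp_iff' _ (envEquiv b).symm.bijective).1 hinj,
      Function.Surjective.of_comp hsurj⟩
  exact ⟨LinearEquiv.ofBijective φ hbij, hφ, hφι⟩

end Connected

/-! ### The primitive part of the free algebra -/

section Free

variable {K E : Type*} [Field K]

/-- The primitive part of the free `2-ass` algebra is generated by `E` as a `Mag(∞)` algebra. -/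
theorem mem_of_op_mem {Q : Submodule K (Prim K (FreeTwoAss K E))}
    (h1 : ∀ e, primGen K e ∈ Q)
    (h2 : ∀ (n : ℕ) (x : Fin (n + 2) → Prim K (FreeTwoAss K E)), (∀ i, x i ∈ Q) →
      MagInf.op (K := K) n x ∈ Q) (x : Prim K (FreeTwoAss K E)) : x ∈ Q := by
  let _ : MagInf K Q :=
    { op := fun n => ((MagInf.op (K := K) n).compLinearMap (fun _ => Q.subtype)).codRestrict Q
        (fun x => h2 n _ (fun i => (x i).2)) }
  -- The generators lie in `Q`, so the free algebra maps to the enveloping algebra of `Q`, and back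
  -- by `r`, with composite the identity. A primitive `x` goes to a primitive of `UEnv K Q`, that is
  -- to an element of `Q`, and `r` returns it as `x`.
  let s : FreeTwoAss K E →ₗ[K] UEnv K Q := freeLift fun e => envι K Q ⟨primGen K e, h1 e⟩
  have hs : IsTwoInfBialgebraHom s :=
    (freeLift_isTwoAssHom _).isTwoInfBialgebraHom generates_gen comul_gen fun e => by
      rw [freeLift_gen]
      exact comul_envι _
  have hop (n : ℕ) (x : Fin (n + 2) → Q) :
      ((Prim K _).subtype ∘ₗ Q.subtype) (MagInf.op (K := K) n x) =
        mu K (FreeTwoAss K E) n (fun i => ((Prim K _).subtype ∘ₗ Q.subtype) (x i)) :=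
    coe_prim_op n fun i => (x i : Prim K (FreeTwoAss K E))
  let r : UEnv K Q →ₗ[K] FreeTwoAss K E := envLift _ hop
  have hrs (a : FreeTwoAss K E) : r (s a) = a :=
    generates_gen.id_of_hom ((envLift_isTwoAssHom _ hop).comp hs.toIsTwoAssHom) (fun e => by
      change r (freeLift _ (gen K e)) = _
      rw [freeLift_gen]
      exact envLift_ι _ hop _) a
  obtain ⟨q, hq⟩ := exists_envι_eq_of_mem_Prim (hs.map_mem_Prim x.2)
  have hx : (x : FreeTwoAss K E) = (q : Prim K (FreeTwoAss K E)) := by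
    rw [← hrs x, ← hq]
    exact envLift_ι _ hop q
  rw [Subtype.ext hx]
  exact q.2

theorem existsUnique_prim_free_lift {N : Type*} [AddCommGroup N] [Module K N] [MagInf K N]
    (f : E → N) : ∃! g : Prim K (FreeTwoAss K E) →ₗ[K] N,
      IsMagInfHom g ∧ ∀ e : E, g (primGen K e) = f e := by
  have hs : IsTwoInfBialgebraHom (freeLift (K := K) fun e => envι K N (f e)) :=
    (freeLift_isTwoAssHom _).isTwoInfBialgebraHom generates_gen comul_gen fun e => by
      rw [freeLift_gen]
      exact comul_envι _
  refine existsUnique_of_exists_of_unique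
    -- The bialgebra morphism to `UEnv K N`, restricted to primitives, with its target identified
    -- with `N`.
    ⟨(primEnvEquiv K N).symm.toLinearMap ∘ₗ primMap hs, fun n x => ?_, fun e => ?_⟩ ?_
  · rw [LinearMap.comp_apply, primMap_isMagInfHom hs n x, primEnvEquiv_symm_isMagInfHom]
    rfl
  · refine (LinearEquiv.symm_apply_eq _).2 (Subtype.ext ?_)
    exact freeLift_gen (K := K) _ e
  · rintro g g' ⟨hg, hge⟩ ⟨hg', hge'⟩
    refine LinearMap.ext (mem_of_op_mem (Q := LinearMap.eqLocus g g')
      (fun e => (hge e).trans (hge' e).symm) fun n x hx => ?_)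
    rw [LinearMap.mem_eqLocus, hg, hg']
    exact congrArg _ (funext hx)

end Free

end TwoInf

end

theorem mainTheorem8 {K : Type u} [Field K] :
    -- (a) a connected bialgebra is the enveloping algebra of its primitive part
    (∀ (A : Type v) [AddCommGroup A] [Module K A] [TwoInf.TwoInfBialgebra K A],
      TwoInf.IsConnected K A →
        ∃ Φ : TwoInf.UEnv K (TwoInf.Prim K A) ≃ₗ[K] A,
          TwoInf.IsTwoInfBialgebraHom Φ.toLinearMap ∧
          ∀ p : TwoInf.Prim K A, Φ (TwoInf.envι K (TwoInf.Prim K A) p) = (p : A)) ∧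
    -- (b) a Mag(∞) algebra is the primitive part of its enveloping algebra
    (∀ (M : Type w) [AddCommGroup M] [Module K M] [TwoInf.MagInf K M],
      ∃ Ψ : M ≃ₗ[K] TwoInf.Prim K (TwoInf.UEnv K M),
        TwoInf.IsMagInfHom Ψ.toLinearMap ∧
        ∀ m : M, (Ψ m : TwoInf.UEnv K M) = TwoInf.envι K M m) ∧
    -- (c) the primitive part of the free 2-ass algebra on a set is the free Mag(∞) algebra
    (∀ (E : Type x) (N : Type y) [AddCommGroup N] [Module K N] [TwoInf.MagInf K N] (f : E → N),
      ∃! g : TwoInf.Prim K (TwoInf.FreeTwoAss K E) →ₗ[K] N,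
        TwoInf.IsMagInfHom g ∧ ∀ e : E, g (TwoInf.primGen K e) = f e) := by
  exact ⟨fun A _ _ _ hA => TwoInf.exists_env_prim_equiv hA,
    fun M _ _ _ => ⟨TwoInf.primEnvEquiv K M, TwoInf.primEnvEquiv_isMagInfHom,
      TwoInf.coe_primEnvEquiv⟩,
    fun E N _ _ _ f => TwoInf.existsUnique_prim_free_lift f⟩
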